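/- **Theorem B.3 (Sard–Smale transversality theorem with parameters).** Let $r\ge 1$ ($r$ an integer or $r=\infty$). Let $\mathcal M$ be a $\mathcal C^r$ manifold of finite dimension $n$, without boundary, that is separable (in the sense of having a countable base of open sets). Let $\mathcal W$ be a $\mathcal C^r$ submanifold of codimension $m<\infty$ of a real Banach space $Y$ (not necessarily closed as a subset of $Y$). Let $\Lambda$ be an open subset of a separable real Banach space, let $\hat\Lambda$ be a dense subset of $\Lambda$, and let $\Phi\in\mathcal C^r(\mathcal M\times\Lambda,Y)$. Assume that (i) $r>n-m$, (ii) $\Phi$ is transversal to $\mathcal W$ at every point $(x,\lambda)\in\mathcal M\times\hat\Lambda$. Then the set of all $\lambda\in\Lambda$ such that the map $x\mapsto\Phi(x,\lambda)$ is transversal to $\mathcal W$ at every point $x\in\mathcal M$ is generic in $\Lambda$, that is, it contains a countable intersection of dense open subsets of $\Lambda$. Here a $\mathcal C^1$ map $f$ from a $\mathcal C^1$ Banach manifold $\mathcal N$ to $Y$ is called *transversal to $\mathcal W$ at $x\in\mathcal N$* if either $f(x)\notin\mathcal W$, or $f(x)\in\mathcal W$ and both of the following hold: $Df(x)^{-1}(T_{f(x)}\mathcal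 W)$ is a closed subspace of $T_x\mathcal N$ that admits a closed complement, and the range $Df(x)(T_x\mathcal N)$ contains a closed complement of $T_{f(x)}\mathcal W$ in $Y$. -/

import Mathlib

open scoped Manifold ContDiff Topology

/-- `W` is a (not necessarily closed) `C^r` submanifold of codimension `m` of the real normed space
`Y`: around each of its points there is a `C^r` chart `φ` of `Y` (a `C^r` diffeomorphism between
open subsets of `Y`) that flattens `W` onto a closed linear subspace `K` of codimension `m`. -/
def IsSubmanifoldOfCodim {Y : Type*} [NormedAddCommGroup Y] [NormedSpace ℝ Y]
    (r : WithTop ℕ∞) (m : ℕ) (W : Set Y) : Prop :=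
  ∀ w ∈ W, ∃ (φ : OpenPartialHomeomorph Y Y) (K : Submodule ℝ Y),
    w ∈ φ.source ∧
    ContDiffOn ℝ r φ φ.source ∧
    ContDiffOn ℝ r φ.symm φ.target ∧
    IsClosed (K : Set Y) ∧
    Module.rank ℝ (Y ⧸ K) = m ∧
    ∀ y ∈ φ.source, y ∈ W ↔ φ y ∈ K

/-- The tangent space `T_w W` of a submanifold `W` of `Y` at `w`: the velocities at `w` of the
curves in `W` through `w`. (For a submanifold these velocities already form a linear subspace, so
that taking the span adds nothing.) -/
def submanifoldTangentSpace {Y : Type*} [NormedAddCommGroup Y] [NormedSpace ℝ Y]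
    (W : Set Y) (w : Y) : Submodule ℝ Y :=
  Submodule.span ℝ
    {v : Y | ∃ γ : ℝ → Y, γ 0 = w ∧ (∀ᶠ t in 𝓝 (0 : ℝ), γ t ∈ W) ∧ HasDerivAt γ v 0}

/-- The `C^1` map `f` from the manifold `M` to the Banach space `Y` is transversal to the
submanifold `W` of `Y` at the point `x`: either `f x ∉ W`, or `f x ∈ W` and
(i) the preimage of `T_{f x} W` under the derivative of `f` at `x` is a closed subspace of `T_x M`
that admits a closed complement, and
(ii) the range of the derivative contains a closed complement of `T_{f x} W` in `Y`. -/
def IsTransversalAt {E : Type*} [NormedAddCommGroup E] [NormedSpace ℝ E]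
    {H : Type*} [TopologicalSpace H] (I : ModelWithCorners ℝ E H)
    {M : Type*} [TopologicalSpace M] [ChartedSpace H M]
    {Y : Type*} [NormedAddCommGroup Y] [NormedSpace ℝ Y]
    (f : M → Y) (W : Set Y) (x : M) : Prop :=
  let D : TangentSpace I x →L[ℝ] Y := mfderiv I 𝓘(ℝ, Y) f x
  let T : Submodule ℝ Y := submanifoldTangentSpace W (f x)
  let P : Submodule ℝ (TangentSpace I x) := T.comap D.toLinearMap
  f x ∉ W ∨
    (f x ∈ W ∧
      (IsClosed (P : Set (TangentSpace I x)) ∧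
        ∃ Q : Submodule ℝ (TangentSpace I x),
          IsClosed (Q : Set (TangentSpace I x)) ∧ IsCompl P Q) ∧
      ∃ C : Submodule ℝ Y, IsClosed (C : Set Y) ∧ IsCompl T C ∧ C ≤ D.toLinearMap.range)

/-! Locally `W` is the zero set of a submersion `h` to `ℝ^m` with tangent space `ker Dh`, and since
this kernel has finite codimension the splitting conditions reduce to surjectivity of `Dh ∘ Df`. In
a chart, with `G = h ∘ Φ`, the bad parameters are those `l` for which `G (·, l)` has a zero where
its derivative is not onto. `isNowhereDense_nonregular_parameters` shows that, over a compact set of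
`x`, they form a nowhere dense set. Countably many such local sets suffice because `M × Λ` is second
countable.

For nowhere density: the bad set is relatively closed, so if its closure had interior it would
contain a nonempty open set, and with it a parameter `l₁` of the dense set. At `l₁` the full
derivative is onto at every zero; by compactness, finitely many parameter directions achieve this
for all nearby parameters. On the affine subspace through `l₁` in these directions almost every
parameter is good, a contradiction.

The finite-dimensional statement `volume_nonregular_parameters_eq_zero` is proved by rank strata.
Near a bad point the zero set of `G` is a manifold with coordinates `(x, y)`, and the parameter, in
suitable linear coordinates, is `(y, β (x, y))`. Where the rank of the partial derivative does not
exceed its value at the centre, `∂β/∂x = 0`. By Fubini it is enough that a `C^r` map `ℝ^q → ℝ^s`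
sends the points of zero derivative to a null set if `q ≤ r s`. This form of Sard's theorem rests on
Morse's decomposition `exists_flat_cover` of an arbitrary set into pieces on which functions
vanishing on the set are flat. -/

/-! ### Local parametrization of zero sets -/

/-- A function that is `C^k` at a point of a finite-dimensional space agrees near this point with
a globally `C^k` function. -/
theorem ContDiffAt.exists_contDiff_eventuallyEq {E F : Type*} [NormedAddCommGroup E]
    [NormedSpace ℝ E] [FiniteDimensional ℝ E] [NormedAddCommGroup F] [NormedSpace ℝ F]
    {k : ℕ} {f : E → F} {a : E} (hf : ContDiffAt ℝ k f a) :
    ∃ g : E → F, ContDiff ℝ k g ∧ g =ᶠ[𝓝 a] f := by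
  have hev : ∀ᶠ x in 𝓝 a, ContDiffAt ℝ k f x := hf.eventually (by simp)
  obtain ⟨ε, hε, hball⟩ := Metric.eventually_nhds_iff_ball.1 hev
  let b : ContDiffBump a := ⟨ε / 3, ε / 2, by positivity, by linarith⟩
  refine ⟨fun x => b x • f x, ?_, ?_⟩
  · rw [contDiff_iff_contDiffAt]
    intro x
    by_cases hx : x ∈ Metric.ball a ε
    · exact b.contDiffAt.smul (hball x hx)
    · have hx' : x ∈ (Metric.closedBall a (ε / 2))ᶜ := by
        simp only [Metric.mem_ball, not_lt, Set.mem_compl_iff, Metric.mem_closedBall, not_le] at hx ⊢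
        linarith
      have h0 : (fun x => b x • f x) =ᶠ[𝓝 x] fun _ => 0 := by
        filter_upwards [Metric.isClosed_closedBall.isOpen_compl.mem_nhds hx'] with y hy
        have : b y = 0 := b.zero_of_le_dist (by
          simp only [Set.mem_compl_iff, Metric.mem_closedBall, not_le] at hy
          exact hy.le)
        simp [this]
      exact contDiffAt_const.congr_of_eventuallyEq h0
  · filter_upwards [Metric.closedBall_mem_nhds a (show 0 < ε / 3 by positivity)] with x hx
    have : b x = 1 := b.one_of_mem_closedBall hx
    simp [this]

/-- Parametrization of a level set by the remaining coordinates: if `(DG(a), p)` is injective and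
dimensions match, then near `a` the zeros of `G` are the values of a `C^k` map `ψ`. -/
theorem exists_zeroSet_parametrization {E F F' : Type*} [NormedAddCommGroup E] [NormedSpace ℝ E]
    [FiniteDimensional ℝ E] [NormedAddCommGroup F] [NormedSpace ℝ F] [FiniteDimensional ℝ F]
    [NormedAddCommGroup F'] [NormedSpace ℝ F'] [FiniteDimensional ℝ F']
    {k : ℕ} (hk : 1 ≤ k) {G : E → F} {a : E} (hG : ContDiffAt ℝ k G a) (hGa : G a = 0)
    (p : E →L[ℝ] F') (hinj : ∀ v, fderiv ℝ G a v = 0 → p v = 0 → v = 0)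
    (hdim : Module.finrank ℝ E = Module.finrank ℝ F + Module.finrank ℝ F') :
    ∃ ψ : F' → E, ContDiff ℝ k ψ ∧ (∀ᶠ e in 𝓝 a, G e = 0 → ψ (p e) = e) ∧
      ∀ᶠ z in 𝓝 (p a), G (ψ z) = 0 ∧ p (ψ z) = z := by
  have hk0 : ((k : ℕ) : WithTop ℕ∞) ≠ 0 := by
    have : k ≠ 0 := by omega
    exact_mod_cast this
  have : CompleteSpace E := FiniteDimensional.complete ℝ E
  -- `(DG(a), p)` is an isomorphism, so `(G, p)` has a local inverse `J`; the map sought is `z ↦ J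
  -- (0, z)`, made global by a cutoff.
  let A : E →L[ℝ] F × F' := (fderiv ℝ G a).prod p
  have hAinj : Function.Injective A := by
    rw [injective_iff_map_eq_zero]
    intro v hv
    exact hinj v (congrArg Prod.fst hv) (congrArg Prod.snd hv)
  let e : E ≃L[ℝ] F × F' := (LinearEquiv.ofInjectiveOfFinrankEq A.toLinearMap hAinj
    (by rw [hdim, Module.finrank_prod])).toContinuousLinearEquiv
  have he : (e : E →L[ℝ] F × F') = A := by ext v <;> rfl
  let H : E → F × F' := fun x => (G x, p x)
  have hH : ContDiffAt ℝ k H a := hG.prodMk p.contDiff.contDiffAt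
  have hH' : HasFDerivAt H (e : E →L[ℝ] F × F') a := by
    rw [he]
    exact (hG.differentiableAt hk0).hasFDerivAt.prodMk p.hasFDerivAt
  have hs := hH.hasStrictFDerivAt' hH' hk0
  let J := hH.localInverse hH' hk0
  have hJ : ContDiffAt ℝ k J (H a) := hH.to_localInverse hH' hk0
  have hHa : H a = (0, p a) := by simp [H, hGa]
  have hl : ∀ᶠ x in 𝓝 a, J (H x) = x := hs.eventually_left_inverse
  have hr : ∀ᶠ y in 𝓝 (H a), H (J y) = y := hs.eventually_right_inverse
  have hψ0 : ContDiffAt ℝ k (fun z : F' => J (0, z)) (p a) := by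
    rw [hHa] at hJ
    exact hJ.comp (p a) (contDiff_const.prodMk contDiff_id).contDiffAt
  obtain ⟨ψ, hψ, hψe⟩ := hψ0.exists_contDiff_eventuallyEq
  refine ⟨ψ, hψ, ?_, ?_⟩
  · filter_upwards [hl, p.continuous.continuousAt.eventually hψe] with x hx hx' hGx
    rw [hx']
    simp only [H, hGx] at hx
    exact hx
  · have hc : Filter.Tendsto (fun z : F' => ((0 : F), z)) (𝓝 (p a)) (𝓝 (H a)) := by
      rw [hHa]
      exact (continuous_const.prodMk continuous_id).continuousAt
    filter_upwards [hψe, hc.eventually hr] with z hz hz'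
    rw [hz]
    exact ⟨congrArg Prod.fst hz', congrArg Prod.snd hz'⟩

/-- A surjective linear map between finite-dimensional spaces can be completed to an isomorphism. -/
theorem exists_complementary_map {E F : Type*} [NormedAddCommGroup E] [NormedSpace ℝ E]
    [FiniteDimensional ℝ E] [NormedAddCommGroup F] [NormedSpace ℝ F] [FiniteDimensional ℝ F]
    (A : E →L[ℝ] F) (hA : Function.Surjective A) :
    ∃ d, Module.finrank ℝ E = Module.finrank ℝ F + d ∧
      ∃ p : E →L[ℝ] (Fin d → ℝ), ∀ v, A v = 0 → p v = 0 → v = 0 := by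
  obtain ⟨g, hg⟩ := LinearMap.exists_leftInverse_of_injective A.ker.subtype
    (Submodule.ker_subtype _)
  let c : A.ker ≃ₗ[ℝ] (Fin (Module.finrank ℝ A.ker) → ℝ) := LinearEquiv.ofFinrankEq _ _ (by simp)
  refine ⟨Module.finrank ℝ A.ker, ?_, (c.toLinearMap ∘ₗ g).toContinuousLinearMap, ?_⟩
  · have h1 := A.toLinearMap.finrank_range_add_finrank_ker
    rw [LinearMap.range_eq_top.2 hA, finrank_top] at h1
    exact h1.symm
  · intro v hv hpv
    have h1 : g v = ⟨v, hv⟩ := LinearMap.congr_fun hg ⟨v, hv⟩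
    have h2 : c (g v) = 0 := hpv
    rw [map_eq_zero_iff c c.injective, h1] at h2
    exact congrArg Subtype.val h2

/-! ### Morse's decomposition and Sard's theorem at points of zero derivative -/

/-- `T` is the image of a bounded set under a `C^1` map along which each `C^k` function that
vanishes on `A` vanishes to order `k`, uniformly, at the points of `T`. -/
def IsFlatPiece {q : ℕ} (k : ℕ) (A T : Set (Fin q → ℝ)) : Prop :=
  ∃ n ≤ q, ∃ (ψ : (Fin n → ℝ) → (Fin q → ℝ)) (S : Set (Fin n → ℝ)),
    Bornology.IsBounded S ∧ ContDiff ℝ 1 ψ ∧ ψ '' S = T ∧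
    ∀ g : (Fin q → ℝ) → ℝ, ContDiff ℝ k g → (∀ a ∈ A, g a = 0) →
      ∀ ε > 0, ∃ δ > 0, ∀ y ∈ S, ∀ x, dist x y < δ → |g (ψ x)| ≤ ε * dist x y ^ k

theorem Finset.exists_pos_forall_of_antitone {ι : Type*} (s : Finset ι) (P : ι → ℝ → Prop)
    (hP : ∀ i, ∀ δ δ', δ' ≤ δ → P i δ → P i δ') (h : ∀ i, ∃ δ > 0, P i δ) :
    ∃ δ > 0, ∀ i ∈ s, P i δ := by
  classical
  induction s using Finset.induction_on with
  | empty => exact ⟨1, one_pos, by simp⟩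
  | insert i s _ ih =>
    obtain ⟨δ, hδ, h1⟩ := ih
    obtain ⟨δ', hδ', h2⟩ := h i
    refine ⟨min δ δ', lt_min hδ hδ', ?_⟩
    intro j hj
    rcases Finset.mem_insert.1 hj with rfl | hj
    · exact hP _ _ _ (min_le_right _ _) h2
    · exact hP _ _ _ (min_le_left _ _) (h1 j hj)

/-- If all partial derivatives of `g` vanish on `A`, then `g` is flat of one order more. -/
theorem flat_of_fderiv_eq_zero {q n k : ℕ} {A : Set (Fin q → ℝ)}
    {ψ : (Fin n → ℝ) → (Fin q → ℝ)} {S : Set (Fin n → ℝ)} (hS : Bornology.IsBounded S)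
    (hψ : ContDiff ℝ 1 ψ)
    (hflat : ∀ g : (Fin q → ℝ) → ℝ, ContDiff ℝ k g → (∀ a ∈ A, g a = 0) →
      ∀ ε > 0, ∃ δ > 0, ∀ y ∈ S, ∀ x, dist x y < δ → |g (ψ x)| ≤ ε * dist x y ^ k)
    {g : (Fin q → ℝ) → ℝ} (hg : ContDiff ℝ (k + 1 : ℕ) g) (hgA : ∀ a ∈ A, fderiv ℝ g a = 0)
    {ε : ℝ} (hε : 0 < ε) :
    ∃ δ > 0, ∀ y ∈ S, ∀ x, dist x y < δ → |g (ψ x) - g (ψ y)| ≤ ε * dist x y ^ (k + 1) := by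
  obtain ⟨K, hK0, hK⟩ : ∃ K > 0, ∀ y ∈ S, ∀ x, dist x y < 1 → ‖fderiv ℝ ψ x‖ ≤ K := by
    obtain ⟨R, hR⟩ := hS.subset_closedBall 0
    have hc : IsCompact (Metric.closedBall (0 : Fin n → ℝ) (R + 1)) := isCompact_closedBall _ _
    obtain ⟨K, hK⟩ := hc.exists_bound_of_continuousOn
      (hψ.continuous_fderiv one_ne_zero).continuousOn
    refine ⟨max K 1, by positivity, fun y hy x hxy => (hK x ?_).trans (le_max_left _ _)⟩
    have h1 := hR hy
    rw [Metric.mem_closedBall] at h1 ⊢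
    linarith [dist_triangle x y 0]
  -- The mean value inequality on the segment from `y` to `x` costs a sum of `q` partial derivatives
  -- and the bound `K` on `Dψ`; `q + 1` keeps the denominator positive when `q = 0`.
  set ε' := ε / ((q + 1) * K) with hε'
  have hε'0 : 0 < ε' := by positivity
  have hgd : Differentiable ℝ g := hg.differentiable (by simp)
  have hpart : ∀ j : Fin q, ∃ δ > 0, ∀ y ∈ S, ∀ x, dist x y < δ →
      |fderiv ℝ g (ψ x) (Pi.single j 1)| ≤ ε' * dist x y ^ k := by
    intro j
    refine hflat (fun x => fderiv ℝ g x (Pi.single j 1)) ?_ ?_ ε' hε'0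
    · exact (hg.fderiv_right (by push_cast; rfl)).clm_apply contDiff_const
    · intro a ha
      simp [hgA a ha]
  obtain ⟨δ, hδ, hδ'⟩ := Finset.exists_pos_forall_of_antitone Finset.univ
    (fun j δ => ∀ y ∈ S, ∀ x, dist x y < δ →
      |fderiv ℝ g (ψ x) (Pi.single j 1)| ≤ ε' * dist x y ^ k)
    (fun j δ δ' h H y hy x hx => H y hy x (hx.trans_le h)) hpart
  refine ⟨min δ 1, by positivity, fun y hy x hxy => ?_⟩
  have hd : ∀ z ∈ segment ℝ y x, ‖fderiv ℝ (g ∘ ψ) z‖ ≤ q * (ε' * dist x y ^ k) * K := by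
    intro z hz
    have hzy : dist z y ≤ dist x y := by
      have := segment_subset_closedBall_left y x hz
      rwa [Metric.mem_closedBall, dist_comm y x] at this
    have hψd : DifferentiableAt ℝ ψ z := hψ.differentiable one_ne_zero z
    rw [fderiv_comp z (hgd _) hψd]
    refine (ContinuousLinearMap.opNorm_comp_le _ _).trans ?_
    have h2 := hK y hy z (hzy.trans_lt (hxy.trans_le (min_le_right _ _)))
    refine mul_le_mul ?_ h2 (norm_nonneg _) (by positivity)
    refine ContinuousLinearMap.opNorm_le_bound _ (by positivity) fun v => ?_
    have hv : v = ∑ j, v j • (Pi.single j 1 : Fin q → ℝ) := by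
      ext i
      simp [Finset.sum_apply, Pi.single_apply]
    conv_lhs => rw [hv, map_sum]
    refine (norm_sum_le _ _).trans ?_
    have : ∀ j ∈ (Finset.univ : Finset (Fin q)),
        ‖fderiv ℝ g (ψ z) (v j • (Pi.single j 1 : Fin q → ℝ))‖ ≤
          ε' * dist x y ^ k * ‖v‖ := by
      intro j hj
      rw [map_smul, norm_smul, mul_comm]
      refine mul_le_mul ?_ (norm_le_pi_norm v j) (norm_nonneg _) (by positivity)
      refine (hδ' j hj y hy z (hzy.trans_lt (hxy.trans_le (min_le_left _ _)))).trans ?_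
      gcongr
    refine (Finset.sum_le_sum this).trans ?_
    simp [mul_assoc]
  have hmv := (convex_segment y x).norm_image_sub_le_of_norm_fderiv_le (f := g ∘ ψ)
    (fun z _ => (hgd _).comp z (hψ.differentiable one_ne_zero z)) hd
    (left_mem_segment ℝ y x) (right_mem_segment ℝ y x)
  rw [← dist_eq_norm x y] at hmv
  refine (Real.norm_eq_abs _ ▸ hmv).trans ?_
  have hq : (q : ℝ) * ε' * K ≤ ε := by
    rw [hε']
    field_simp
    linarith
  calc q * (ε' * dist x y ^ k) * K * dist x y = (q * ε' * K) * dist x y ^ (k + 1) := by ring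
    _ ≤ _ := by gcongr

theorem IsFlatPiece.succ {q k : ℕ} {A A' T : Set (Fin q → ℝ)} (hTA : T ⊆ A)
    (hA' : ∀ g : (Fin q → ℝ) → ℝ, ContDiff ℝ (k + 1 : ℕ) g → (∀ a ∈ A, g a = 0) →
      ∀ a ∈ A', fderiv ℝ g a = 0)
    (hT : IsFlatPiece k A' T) : IsFlatPiece (k + 1) A T := by
  obtain ⟨n, hn, ψ, S, hS, hψ, rfl, hflat⟩ := hT
  refine ⟨n, hn, ψ, S, hS, hψ, rfl, fun g hg hgA ε hε => ?_⟩
  obtain ⟨δ, hδ, h⟩ := flat_of_fderiv_eq_zero hS hψ hflat hg (hA' g hg hgA) hε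
  refine ⟨δ, hδ, fun y hy x hxy => ?_⟩
  have := h y hy x hxy
  rwa [hgA _ (hTA (Set.mem_image_of_mem _ hy)), sub_zero] at this

theorem IsFlatPiece.image {q q' k : ℕ} (hq : q' ≤ q) (hk : 1 ≤ k)
    {φ : (Fin q' → ℝ) → (Fin q → ℝ)} (hφ : ContDiff ℝ k φ) {A : Set (Fin q → ℝ)}
    {T : Set (Fin q' → ℝ)} (hT : IsFlatPiece k (φ ⁻¹' A) T) : IsFlatPiece k A (φ '' T) := by
  obtain ⟨n, hn, ψ, S, hS, hψ, rfl, hflat⟩ := hT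
  refine ⟨n, hn.trans hq, φ ∘ ψ, S, hS, (hφ.of_le (by exact_mod_cast hk)).comp hψ,
    Set.image_comp _ _ _, fun g hg hgA ε hε => ?_⟩
  exact hflat (g ∘ φ) (hg.comp hφ) (fun a ha => hgA _ ha) ε hε

/-- Double induction on `q` and `k`. Where every test function vanishing on `A` also has zero
derivative, flatness of the partial derivatives gains one order. Elsewhere `A` lies locally in a
smooth hypersurface, which lowers `q`. -/
theorem exists_flat_cover (q : ℕ) : ∀ (k : ℕ) (A : Set (Fin q → ℝ)),
    ∃ 𝒯 : Set (Set (Fin q → ℝ)), 𝒯.Countable ∧ A = ⋃₀ 𝒯 ∧ ∀ T ∈ 𝒯, IsFlatPiece k A T := by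
  induction q using Nat.strong_induction_on with
  | _ q ihq =>
  intro k
  induction k with
  | zero =>
    intro A
    -- Flatness of order `0` is uniform continuity on a compact neighbourhood of a bounded piece.
    refine ⟨Set.range fun i : ℕ => A ∩ Metric.closedBall 0 i, Set.countable_range _, ?_, ?_⟩
    · ext a
      simp only [Set.sUnion_range, Set.mem_iUnion, Set.mem_inter_iff, Metric.mem_closedBall,
        exists_and_left, iff_self_and]
      exact fun _ => exists_nat_ge _
    · rintro _ ⟨i, rfl⟩
      refine ⟨q, le_rfl, id, _, Metric.isBounded_closedBall.subset Set.inter_subset_right,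
        contDiff_id, Set.image_id _, fun g hg hgA ε hε => ?_⟩
      have hc : IsCompact (Metric.closedBall (0 : Fin q → ℝ) (i + 1)) := isCompact_closedBall _ _
      have hu := hc.uniformContinuousOn_of_continuous hg.continuous.continuousOn
      obtain ⟨δ, hδ, h⟩ := Metric.uniformContinuousOn_iff_le.1 hu ε hε
      refine ⟨min δ 1, by positivity, fun y hy x hxy => ?_⟩
      have hyi : dist y 0 ≤ i := hy.2
      have hx : x ∈ Metric.closedBall (0 : Fin q → ℝ) (i + 1) := by
        rw [Metric.mem_closedBall]
        linarith [dist_triangle x y 0, hxy.trans_le (min_le_right _ _)]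
      have := h x hx y (by rw [Metric.mem_closedBall]; linarith)
        (hxy.le.trans (min_le_left _ _))
      rw [hgA y hy.1, Real.dist_eq, sub_zero] at this
      simpa using this
  | succ k ihk =>
    intro A
    let A' : Set (Fin q → ℝ) := {a ∈ A | ∀ g : (Fin q → ℝ) → ℝ, ContDiff ℝ (k + 1 : ℕ) g →
      (∀ a ∈ A, g a = 0) → fderiv ℝ g a = 0}
    have hA'A : A' ⊆ A := fun a ha => ha.1
    obtain ⟨𝒯, h𝒯c, h𝒯A, h𝒯⟩ := ihk A'
    have hloc : ∀ a ∈ A \ A', ∃ N ∈ 𝓝 a, ∃ 𝒰 : Set (Set (Fin q → ℝ)), 𝒰.Countable ∧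
        A ∩ N ⊆ ⋃₀ 𝒰 ∧ ⋃₀ 𝒰 ⊆ A ∧ ∀ T ∈ 𝒰, IsFlatPiece (k + 1) A T := by
      rintro a ⟨ha, ha'⟩
      obtain ⟨g, hg, hgA, hga⟩ : ∃ g : (Fin q → ℝ) → ℝ, ContDiff ℝ (k + 1 : ℕ) g ∧
          (∀ a ∈ A, g a = 0) ∧ fderiv ℝ g a ≠ 0 := by
        by_contra! hcon
        exact ha' ⟨ha, hcon⟩
      have hsurj : Function.Surjective (fderiv ℝ g a) := by
        refine LinearMap.surjective (f := (fderiv ℝ g a).toLinearMap) fun h0 => hga ?_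
        ext v
        exact LinearMap.congr_fun h0 _
      obtain ⟨d, hd, p, hp⟩ := exists_complementary_map _ hsurj
      -- The hypersurface `g = 0` contains `A` and is regular at `a`; its parametrization `φ` is
      -- `C^(k+1)`, so test functions pull back to test functions for `φ ⁻¹' A`.
      obtain ⟨φ, hφ, hz, -⟩ := exists_zeroSet_parametrization (by omega : 1 ≤ k + 1)
        hg.contDiffAt (hgA a ha) p hp (by simpa using hd)
      have hdq : d < q := by
        simp at hd
        omega
      obtain ⟨𝒱, h𝒱c, h𝒱A, h𝒱⟩ := ihq d hdq (k + 1) (φ ⁻¹' A)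
      refine ⟨_, hz, (fun T => φ '' T) '' 𝒱, h𝒱c.image _, ?_, ?_, ?_⟩
      · rintro b ⟨hb, hbz⟩
        have hb1 : φ (p b) = b := hbz (hgA b hb)
        have hb2 : p b ∈ ⋃₀ 𝒱 := h𝒱A ▸ (show φ (p b) ∈ A by rwa [hb1])
        obtain ⟨T, hT, hbT⟩ := hb2
        exact ⟨φ '' T, ⟨T, hT, rfl⟩, p b, hbT, hb1⟩
      · rintro _ ⟨_, ⟨T, hT, rfl⟩, z, hz, rfl⟩
        have : z ∈ φ ⁻¹' A := h𝒱A ▸ ⟨T, hT, hz⟩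
        exact this
      · rintro _ ⟨T, hT, rfl⟩
        exact (h𝒱 T hT).image hdq.le (by omega) hφ
    choose! N hN 𝒰 h𝒰c h𝒰N h𝒰A h𝒰 using hloc
    obtain ⟨t, htA, htc, htcov⟩ := TopologicalSpace.countable_cover_nhdsWithin
      (s := A \ A') (f := N) fun a ha => mem_nhdsWithin_of_mem_nhds (hN a ha)
    refine ⟨𝒯 ∪ ⋃ a ∈ t, 𝒰 a, h𝒯c.union (htc.biUnion fun a ha => h𝒰c a (htA ha)), ?_, ?_⟩
    · rw [Set.sUnion_union, ← h𝒯A]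
      refine Set.Subset.antisymm (fun b hb => ?_) (Set.union_subset hA'A ?_)
      · by_cases hb' : b ∈ A'
        · exact Or.inl hb'
        · right
          obtain ⟨a, ha, hab⟩ := Set.mem_iUnion₂.1 (htcov ⟨hb, hb'⟩)
          obtain ⟨T, hT, hbT⟩ := h𝒰N a (htA ha) ⟨hb, hab⟩
          exact ⟨T, Set.mem_biUnion ha hT, hbT⟩
      · rintro b ⟨T, hT, hbT⟩
        obtain ⟨a, ha, hTa⟩ := Set.mem_iUnion₂.1 hT
        exact h𝒰A a (htA ha) ⟨T, hTa, hbT⟩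
    · rintro T (hT | hT)
      · refine IsFlatPiece.succ (fun b hb => hA'A (h𝒯A ▸ ⟨T, hT, hb⟩))
          (fun g hg hgA a ha => ha.2 g hg hgA) (h𝒯 T hT)
      · obtain ⟨a, ha, hTa⟩ := Set.mem_iUnion₂.1 hT
        exact h𝒰 a (htA ha) T hTa

-- The partial derivatives of `f` vanish on `A`, so `f ∘ ψ` is Hölder of exponent `k + 1` on small
-- parts of `S`, with arbitrarily small constant `ε`. Hence the measure of the image is at most
-- `ε^s` times the Hausdorff measure of `S` in dimension `(k + 1) s ≥ q`, which is finite.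
open MeasureTheory in
theorem IsFlatPiece.volume_image_eq_zero {q s k : ℕ} (hs : 1 ≤ s) (hqs : q ≤ (k + 1) * s)
    {f : (Fin q → ℝ) → (Fin s → ℝ)} (hf : ContDiff ℝ (k + 1 : ℕ) f) {A T : Set (Fin q → ℝ)}
    (hfA : ∀ a ∈ A, fderiv ℝ f a = 0) (hT : IsFlatPiece k A T) : volume (f '' T) = 0 := by
  obtain ⟨n, hn, ψ, S, hS, hψ, rfl, hflat⟩ := hT
  have key : ∀ ε : ℝ, 0 < ε → ∃ δ > 0, ∀ y ∈ S, ∀ x, dist x y < δ →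
      dist (f (ψ x)) (f (ψ y)) ≤ ε * dist x y ^ (k + 1) := by
    intro ε hε
    have hd : Differentiable ℝ f := hf.differentiable (by simp)
    obtain ⟨δ, hδ, h⟩ := Finset.exists_pos_forall_of_antitone (Finset.univ : Finset (Fin s))
      (fun j δ => ∀ y ∈ S, ∀ x, dist x y < δ →
        |f (ψ x) j - f (ψ y) j| ≤ ε * dist x y ^ (k + 1))
      (fun j δ δ' h H y hy x hx => H y hy x (hx.trans_le h))
      (fun j => by
        refine flat_of_fderiv_eq_zero (g := fun x => f x j) hS hψ hflat
          (contDiff_pi.1 hf j) (fun a ha => ?_) hε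
        have := ((hasFDerivAt_pi'.1 (hd a).hasFDerivAt) j).fderiv
        rw [this, hfA a ha]
        rfl)
    refine ⟨δ, hδ, fun y hy x hxy => ?_⟩
    rw [dist_pi_le_iff (by positivity)]
    intro j
    exact h j (Finset.mem_univ _) y hy x hxy
  let D : ℝ := ((k + 1 : ℕ) : ℝ) * s
  have hfin : Measure.hausdorffMeasure D S < ⊤ := by
    have h1 : (n : ℝ) ≤ D := by
      simp only [D]
      exact_mod_cast hn.trans hqs
    refine (Measure.hausdorffMeasure_mono h1 S).trans_lt ?_
    have h2 : (n : ℝ) = Fintype.card (Fin n) := by simp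
    rw [h2, hausdorffMeasure_pi_real]
    exact hS.measure_lt_top
  -- `S` need not be measurable; `B` has the same measure and makes the sum over the partition
  -- additive.
  obtain ⟨B, hSB, hBm, hB⟩ := exists_measurable_superset (Measure.hausdorffMeasure D) S
  have hbound : ∀ ε : NNReal, 0 < ε →
      volume (f '' (ψ '' S)) ≤ (ε : ENNReal) ^ (s : ℝ) * Measure.hausdorffMeasure D S := by
    intro ε hε
    obtain ⟨δ, hδ, hδ'⟩ := key ε (by exact_mod_cast hε)
    obtain ⟨P, hPm, hPb, hPd, hPu, hPdis⟩ :=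
      SeparableSpace.exists_measurable_partition_diam_le (Fin n → ℝ) (half_pos hδ)
    have hcov : f '' (ψ '' S) ⊆ ⋃ i, (f ∘ ψ) '' (S ∩ P i) := by
      rw [← Set.image_comp, ← Set.image_iUnion, ← Set.inter_iUnion, hPu, Set.inter_univ]
    have hpiece : ∀ i, volume ((f ∘ ψ) '' (S ∩ P i)) ≤
        (ε : ENNReal) ^ (s : ℝ) * Measure.hausdorffMeasure D (B ∩ P i) := by
      intro i
      have hh : HolderOnWith ε ((k + 1 : ℕ) : NNReal) (f ∘ ψ) (S ∩ P i) := by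
        intro x hx y hy
        have hxy : dist x y < δ :=
          (Metric.dist_le_diam_of_mem (hPb i) hx.2 hy.2).trans_lt
            ((hPd i).trans_lt (half_lt_self hδ))
        have h3 := hδ' y hy.1 x hxy
        rw [NNReal.coe_natCast, ENNReal.rpow_natCast, edist_dist, edist_dist,
          ← ENNReal.ofReal_pow dist_nonneg, ← ENNReal.ofReal_coe_nnreal,
          ← ENNReal.ofReal_mul (by positivity)]
        exact ENNReal.ofReal_le_ofReal h3
      have h4 := hh.hausdorffMeasure_image_le (by positivity) (d := (s : ℝ)) (by positivity)
      have h2 : (s : ℝ) = Fintype.card (Fin s) := by simp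
      rw [← hausdorffMeasure_pi_real, ← h2]
      refine h4.trans ?_
      rw [NNReal.coe_natCast]
      gcongr
    calc volume (f '' (ψ '' S)) ≤ ∑' i, volume ((f ∘ ψ) '' (S ∩ P i)) :=
          (measure_mono hcov).trans (measure_iUnion_le _)
      _ ≤ ∑' i, (ε : ENNReal) ^ (s : ℝ) * Measure.hausdorffMeasure D (B ∩ P i) :=
          ENNReal.tsum_le_tsum hpiece
      _ = (ε : ENNReal) ^ (s : ℝ) * Measure.hausdorffMeasure D (⋃ i, B ∩ P i) := by
          rw [ENNReal.tsum_mul_left, measure_iUnion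
            (fun i j hij => (hPdis hij).mono Set.inter_subset_right Set.inter_subset_right)
            (fun i => hBm.inter (hPm i))]
      _ = _ := by rw [← Set.inter_iUnion, hPu, Set.inter_univ, hB]
  have hs0 : (0 : ℝ) < s := by exact_mod_cast hs
  have hlim : Filter.Tendsto
      (fun ε : NNReal => (ε : ENNReal) ^ (s : ℝ) * Measure.hausdorffMeasure D S)
      (𝓝[>] 0) (𝓝 0) := by
    have h1 : Filter.Tendsto (fun ε : NNReal => (ε : ENNReal) ^ (s : ℝ)) (𝓝[>] 0) (𝓝 0) := by
      have h2 : Continuous fun ε : NNReal => (ε : ENNReal) ^ (s : ℝ) :=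
        ENNReal.continuous_rpow_const.comp ENNReal.continuous_coe
      have h3 := h2.tendsto 0
      rw [ENNReal.coe_zero, ENNReal.zero_rpow_of_pos hs0] at h3
      exact h3.mono_left nhdsWithin_le_nhds
    have := ENNReal.Tendsto.mul_const h1 (Or.inr hfin.ne)
    rwa [zero_mul] at this
  have : volume (f '' (ψ '' S)) ≤ 0 :=
    ge_of_tendsto hlim (by filter_upwards [self_mem_nhdsWithin] with ε hε using hbound ε hε)
  exact le_antisymm this bot_le

/-- The values of a `C^r` map `ℝ^q → ℝ^s` at points where its derivative vanishes form a null set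
as soon as `q ≤ r s`. -/
theorem volume_image_eq_zero_of_fderiv_eq_zero {q s r : ℕ} (hs : 1 ≤ s) (hr : 1 ≤ r)
    (hqs : q ≤ r * s) {f : (Fin q → ℝ) → (Fin s → ℝ)} (hf : ContDiff ℝ r f)
    {A : Set (Fin q → ℝ)} (hfA : ∀ a ∈ A, fderiv ℝ f a = 0) : MeasureTheory.volume (f '' A) = 0 := by
  obtain ⟨k, rfl⟩ : ∃ k, r = k + 1 := ⟨r - 1, by omega⟩
  obtain ⟨𝒯, h𝒯c, h𝒯A, h𝒯⟩ := exists_flat_cover q k A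
  rw [h𝒯A, Set.sUnion_eq_biUnion, Set.image_iUnion₂, MeasureTheory.measure_biUnion_null_iff h𝒯c]
  exact fun T hT => (h𝒯 T hT).volume_image_eq_zero hs hqs hf hfA

/-! ### Stability of surjectivity and quotient coordinates -/

/-- Surjectivity onto a finite-dimensional space is an open condition, with a right inverse working
uniformly. -/
theorem ContinuousLinearMap.exists_eventually_surjective_comp {E F : Type*}
    [NormedAddCommGroup E] [NormedSpace ℝ E] [NormedAddCommGroup F] [NormedSpace ℝ F]
    [FiniteDimensional ℝ F] {A : E →L[ℝ] F} (hA : Function.Surjective A) :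
    ∃ T : F →L[ℝ] E, ∀ᶠ A' : E →L[ℝ] F in 𝓝 A, Function.Surjective (A' ∘L T) := by
  obtain ⟨T, hT⟩ := A.exists_rightInverse_of_surjective (LinearMap.range_eq_top.2 hA)
  refine ⟨T, ?_⟩
  have hc : Continuous fun A' : E →L[ℝ] F => A' ∘L T := continuous_id.clm_comp continuous_const
  have ho : {B : F →L[ℝ] F | Function.Injective B} ∈ 𝓝 (A ∘L T) :=
    ContinuousLinearMap.isOpen_injective.mem_nhds (by
      rw [Set.mem_ofPred_eq, hT]
      exact Function.injective_id)
  filter_upwards [hc.continuousAt ho] with A' hA'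
  exact LinearMap.injective_iff_surjective (f := (A' ∘L T).toLinearMap) |>.1 hA'

theorem ContinuousLinearMap.eventually_surjective {E F : Type*}
    [NormedAddCommGroup E] [NormedSpace ℝ E] [NormedAddCommGroup F] [NormedSpace ℝ F]
    [FiniteDimensional ℝ F] {A : E →L[ℝ] F} (hA : Function.Surjective A) :
    ∀ᶠ A' : E →L[ℝ] F in 𝓝 A, Function.Surjective A' := by
  obtain ⟨T, hT⟩ := exists_eventually_surjective_comp hA
  filter_upwards [hT] with A' hA' using Function.Surjective.of_comp (g := T) hA'

/-- A subspace of a finite-dimensional space is the kernel of a map onto some `ℝ^s`. -/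
theorem Submodule.exists_ker_eq {F : Type*} [NormedAddCommGroup F] [NormedSpace ℝ F]
    [FiniteDimensional ℝ F] (R : Submodule ℝ F) :
    ∃ s, Module.finrank ℝ F = Module.finrank ℝ R + s ∧
      ∃ c : F →L[ℝ] (Fin s → ℝ), Function.Surjective c ∧ ∀ v, c v = 0 ↔ v ∈ R := by
  let e : (F ⧸ R) ≃ₗ[ℝ] (Fin (Module.finrank ℝ (F ⧸ R)) → ℝ) := LinearEquiv.ofFinrankEq _ _ (by simp)
  refine ⟨_, ?_, (e.toLinearMap ∘ₗ R.mkQ).toContinuousLinearMap, ?_, ?_⟩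
  · rw [add_comm]
    exact (R.finrank_quotient_add_finrank).symm
  · exact e.surjective.comp R.mkQ_surjective
  · intro v
    change e (R.mkQ v) = 0 ↔ _
    rw [map_eq_zero_iff e e.injective]
    exact Submodule.Quotient.mk_eq_zero R

/-! ### Parametric transversality in finite dimensions -/

open MeasureTheory in
/-- The graph-like set `{(y, β(x, y)) : ∂_x β(x, y) = 0}` is null, locally in `(x, y)`. -/
theorem volume_prod_criticalGraph_eq_zero {q d s r : ℕ} (hs : 1 ≤ s) (hr : 1 ≤ r)
    (hqs : q ≤ r * s) {β : (Fin q → ℝ) × (Fin d → ℝ) → (Fin s → ℝ)} (hβ : ContDiff ℝ r β)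
    {K : Set ((Fin q → ℝ) × (Fin d → ℝ))} (hK : IsCompact K) :
    (volume : Measure ((Fin d → ℝ) × (Fin s → ℝ))) ((fun z => (z.2, β z)) ''
      (K ∩ {z | fderiv ℝ β z ∘L ContinuousLinearMap.inl ℝ (Fin q → ℝ) (Fin d → ℝ) = 0})) = 0 := by
  have hr0 : ((r : ℕ) : WithTop ℕ∞) ≠ 0 := by
    have : r ≠ 0 := by omega
    exact_mod_cast this
  have hc : Continuous fun z =>
      fderiv ℝ β z ∘L ContinuousLinearMap.inl ℝ (Fin q → ℝ) (Fin d → ℝ) :=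
    (hβ.continuous_fderiv hr0).clm_comp continuous_const
  -- Compactness supplies the measurability that Fubini requires; the slices over fixed `y` are then
  -- null by Sard's theorem.
  have hJ : IsCompact ((fun z => (z.2, β z)) ''
      (K ∩ {z | fderiv ℝ β z ∘L ContinuousLinearMap.inl ℝ (Fin q → ℝ) (Fin d → ℝ) = 0})) :=
    (hK.inter_right (isClosed_eq hc continuous_const)).image
      (continuous_snd.prodMk hβ.continuous)
  rw [Measure.volume_eq_prod, Measure.measure_prod_null hJ.isClosed.measurableSet]
  refine Filter.Eventually.of_forall fun y => ?_
  refine measure_mono_null ?_ (volume_image_eq_zero_of_fderiv_eq_zero hs hr hqs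
    (f := fun x => β (x, y))
    (A := {x | fderiv ℝ β (x, y) ∘L ContinuousLinearMap.inl ℝ (Fin q → ℝ) (Fin d → ℝ) = 0})
    (hβ.comp (contDiff_id.prodMk contDiff_const)) ?_)
  · rintro v ⟨⟨x, y'⟩, ⟨-, hx⟩, heq⟩
    obtain ⟨rfl, rfl⟩ := Prod.mk.inj heq
    exact ⟨x, hx, rfl⟩
  · intro x hx
    have h1 : HasFDerivAt β (fderiv ℝ β (x, y)) (x, y) :=
      (hβ.differentiable hr0 _).hasFDerivAt
    have h2 := HasFDerivAt.comp (f := fun x => (x, y)) x h1 (hasFDerivAt_prodMk_left x y)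
    exact h2.fderiv.trans hx

open MeasureTheory in
set_option synthInstance.maxSize 256 in
/-- Parametric transversality in finite dimensions, near a point. -/
theorem exists_nhds_volume_eq_zero {X F : Type*} [NormedAddCommGroup X] [NormedSpace ℝ X]
    [FiniteDimensional ℝ X] [NormedAddCommGroup F] [NormedSpace ℝ F] [FiniteDimensional ℝ F]
    {d r : ℕ} (hr : 1 ≤ r) (hdim : Module.finrank ℝ X < r + Module.finrank ℝ F)
    {G : X × (Fin d → ℝ) → F} {a : X × (Fin d → ℝ)} (hG : ContDiffAt ℝ r G a) (hGa : G a = 0)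
    (hsurj : Function.Surjective (fderiv ℝ G a))
    (hns : ¬ Function.Surjective (fderiv ℝ G a ∘L ContinuousLinearMap.inl ℝ X (Fin d → ℝ))) :
    ∃ N ∈ 𝓝 a, volume (Prod.snd '' {e ∈ N | G e = 0 ∧
      Module.finrank ℝ (fderiv ℝ G e ∘L ContinuousLinearMap.inl ℝ X (Fin d → ℝ)).range ≤
      Module.finrank ℝ (fderiv ℝ G a ∘L ContinuousLinearMap.inl ℝ X (Fin d → ℝ)).range}) = 0 := by
  have hr0 : ((r : ℕ) : WithTop ℕ∞) ≠ 0 := by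
    have : r ≠ 0 := by omega
    exact_mod_cast this
  set A := fderiv ℝ G a ∘L ContinuousLinearMap.inl ℝ X (Fin d → ℝ) with hA
  set ρ := Module.finrank ℝ A.range with hρ
  obtain ⟨q, hq, pb, hpb⟩ := exists_complementary_map A.rangeRestrict
    (A.toLinearMap.surjective_rangeRestrict)
  have hpb' : ∀ v, A v = 0 → pb v = 0 → v = 0 := fun v hv => hpb v (Subtype.ext hv)
  obtain ⟨s, hs, c, hcs, hc⟩ := A.range.exists_ker_eq
  -- `C` is the parameter derivative modulo the range of `A`; it is onto because the full derivative
  -- is. The zero set gets the coordinates `pb` on `ker A` and `pm` on `ker C`.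
  let C : (Fin d → ℝ) →L[ℝ] (Fin s → ℝ) :=
    c ∘L fderiv ℝ G a ∘L ContinuousLinearMap.inr ℝ X (Fin d → ℝ)
  have hsplit : ∀ e : X × (Fin d → ℝ), ∀ v w, fderiv ℝ G e (v, w) =
      fderiv ℝ G e (v, 0) + fderiv ℝ G e (0, w) := by
    intro e v w
    rw [← map_add]
    simp
  have hcA : ∀ v, c (fderiv ℝ G a (v, 0)) = 0 := fun v => (hc _).2 ⟨v, rfl⟩
  have hC : Function.Surjective C := by
    intro y
    obtain ⟨f, rfl⟩ := hcs y
    obtain ⟨⟨v, w⟩, rfl⟩ := hsurj f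
    refine ⟨w, ?_⟩
    rw [hsplit, map_add, hcA, zero_add]
    rfl
  obtain ⟨d', hd', pm, hpm⟩ := exists_complementary_map C hC
  let p : X × (Fin d → ℝ) →L[ℝ] (Fin q → ℝ) × (Fin d' → ℝ) := pb.prodMap pm
  have hinj : ∀ v, fderiv ℝ G a v = 0 → p v = 0 → v = 0 := by
    rintro ⟨v, w⟩ h0 hp
    have hp1 : pb v = 0 := congrArg Prod.fst hp
    have hp2 : pm w = 0 := congrArg Prod.snd hp
    have hw : w = 0 := by
      refine hpm w ?_ hp2
      have : c (fderiv ℝ G a (v, w)) = 0 := by rw [h0, map_zero]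
      rw [hsplit, map_add, hcA, zero_add] at this
      exact this
    subst hw
    rw [hpb' v h0 hp1]
    rfl
  have hs1 : 1 ≤ s := by
    by_contra hs0
    have h1 : A.range = ⊤ := Submodule.eq_top_of_finrank_eq (by omega)
    exact hns (LinearMap.range_eq_top.1 h1)
  simp only [Module.finrank_fin_fun] at hd'
  obtain ⟨ψ, hψ, hz, hz'⟩ := exists_zeroSet_parametrization hr hG hGa p hinj (by
    simp only [Module.finrank_prod, Module.finrank_fin_fun]
    omega)
  let β : (Fin q → ℝ) × (Fin d' → ℝ) → (Fin s → ℝ) := fun z => C (ψ z).2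
  have hβ : ContDiff ℝ r β := C.contDiff.comp (contDiff_snd.comp hψ)
  -- Rank-nullity gives `q - s = dim X - dim F < r`, and `r + s - 1 ≤ r * s` because `(r - 1) * (s -
  -- 1) ≥ 0`.
  have hqs : q ≤ r * s := by
    have h1 : q + 1 ≤ r + s := by omega
    nlinarith
  -- the derivative of `(G, p)` stays injective near `a`
  have hinj' : ∀ᶠ e in 𝓝 a, ∀ v, fderiv ℝ G e v = 0 → p v = 0 → v = 0 := by
    have hcont : ContinuousAt (fun e => (fderiv ℝ G e).prod p) a := by
      have h1 : ∀ e, (fderiv ℝ G e).prod p =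
          ContinuousLinearMap.inl ℝ F ((Fin q → ℝ) × (Fin d' → ℝ)) ∘L fderiv ℝ G e +
            ContinuousLinearMap.inr ℝ F ((Fin q → ℝ) × (Fin d' → ℝ)) ∘L p := by
        refine fun e => ContinuousLinearMap.ext fun v => ?_
        simp
      simp only [h1]
      exact (continuousAt_const.clm_comp (hG.continuousAt_fderiv hr0)).add continuousAt_const
    have ho : {B : X × (Fin d → ℝ) →L[ℝ] F × (Fin q → ℝ) × (Fin d' → ℝ) |
        Function.Injective B} ∈ 𝓝 ((fderiv ℝ G a).prod p) :=
      ContinuousLinearMap.isOpen_injective.mem_nhds (by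
        rw [Set.mem_ofPred_eq, injective_iff_map_eq_zero]
        exact fun v hv => hinj v (congrArg Prod.fst hv) (congrArg Prod.snd hv))
    filter_upwards [hcont ho] with e he v h1 h2
    rw [Set.mem_preimage, Set.mem_ofPred_eq, injective_iff_map_eq_zero] at he
    exact he v (Prod.ext h1 h2)
  have hGd : ∀ᶠ e in 𝓝 a, DifferentiableAt ℝ G e := by
    filter_upwards [hG.eventually (by simp)] with e he using he.differentiableAt hr0
  have hpc := p.continuous.continuousAt (x := a)
  have hKn := hpc.eventually (Metric.closedBall_mem_nhds (p a) one_pos)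
  refine ⟨_, Filter.inter_mem (hz.and (hpc.eventually hz'.eventually_nhds))
    (Filter.inter_mem (hinj'.and hGd) hKn), ?_⟩
  -- In the linear coordinates `(pm, C)` on the parameter space, the bad parameters lie on the
  -- critical graph of `β`; a linear isomorphism preserves null sets.
  let e₀ : (Fin d → ℝ) →L[ℝ] (Fin d' → ℝ) × (Fin s → ℝ) := pm.prod C
  have he₀ : Function.Injective e₀ := by
    rw [injective_iff_map_eq_zero]
    exact fun v hv => hpm v (congrArg Prod.snd hv) (congrArg Prod.fst hv)
  let e : (Fin d → ℝ) ≃L[ℝ] (Fin d' → ℝ) × (Fin s → ℝ) :=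
    (LinearEquiv.ofInjectiveOfFinrankEq e₀.toLinearMap he₀ (by
      simp only [Module.finrank_prod, Module.finrank_fin_fun]
      omega)).toContinuousLinearEquiv
  have hnull := volume_prod_criticalGraph_eq_zero hs1 hr hqs hβ (isCompact_closedBall (p a) 1)
  rw [Measure.volume_eq_prod] at hnull
  have hmap : Measure.map e volume ≪
      (volume : Measure (Fin d' → ℝ)).prod (volume : Measure (Fin s → ℝ)) :=
    Measure.absolutelyContinuous_isAddHaarMeasure _ _
  have h0 := hmap hnull
  have hem : MeasurableEmbedding e := e.toHomeomorph.measurableEmbedding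
  rw [hem.map_apply] at h0
  refine measure_mono_null ?_ h0
  rintro _ ⟨⟨x, l⟩, ⟨⟨⟨h1, h2⟩, ⟨h3, h4⟩, h5⟩, hGx, hrank⟩, rfl⟩
  have hψx : ψ (p (x, l)) = (x, l) := h1 hGx
  refine ⟨p (x, l), ⟨h5, ?_⟩, ?_⟩
  · have hψd : HasFDerivAt ψ (fderiv ℝ ψ (p (x, l))) (p (x, l)) :=
      (hψ.differentiable hr0 _).hasFDerivAt
    have hGψ : fderiv ℝ G (x, l) ∘L fderiv ℝ ψ (p (x, l)) = 0 := by
      have h6 : HasFDerivAt (G ∘ ψ) (fderiv ℝ G (x, l) ∘L fderiv ℝ ψ (p (x, l))) (p (x, l)) := by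
        refine HasFDerivAt.comp _ ?_ hψd
        rw [hψx]
        exact h4.hasFDerivAt
      refine h6.unique ((hasFDerivAt_const (0 : F) _).congr_of_eventuallyEq ?_)
      filter_upwards [h2] with z hz using hz.1
    have hpψ : p ∘L fderiv ℝ ψ (p (x, l)) = ContinuousLinearMap.id ℝ _ := by
      refine (p.hasFDerivAt.comp _ hψd).unique
        ((hasFDerivAt_id _).congr_of_eventuallyEq ?_)
      filter_upwards [h2] with z hz using hz.2
    have hβd : fderiv ℝ β (p (x, l)) =
        C ∘L ContinuousLinearMap.snd ℝ X (Fin d → ℝ) ∘L fderiv ℝ ψ (p (x, l)) :=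
      (C.hasFDerivAt.comp _ (hasFDerivAt_snd.comp _ hψd)).fderiv
    set A' := fderiv ℝ G (x, l) ∘L ContinuousLinearMap.inl ℝ X (Fin d → ℝ) with hA'
    -- every value of the partial derivative is attained on `ker pb`
    have hker : pb.ker.map A'.toLinearMap = A'.range := by
      refine Submodule.eq_of_le_of_finrank_le (LinearMap.map_le_range) (hrank.trans ?_)
      have h7 : Function.Injective (A'.toLinearMap.domRestrict pb.ker) := by
        rw [injective_iff_map_eq_zero]
        rintro ⟨v, hv⟩ hv0
        have := h3 (v, 0) hv0 (Prod.ext hv (map_zero pm))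
        exact Subtype.ext (congrArg Prod.fst this)
      have h8 : Module.finrank ℝ (pb.ker.map A'.toLinearMap) = Module.finrank ℝ pb.ker := by
        rw [← LinearMap.range_domRestrict]
        exact LinearMap.finrank_range_of_inj h7
      have h9 := pb.toLinearMap.finrank_range_add_finrank_ker
      have h10 := pb.toLinearMap.range.finrank_le
      rw [Module.finrank_fin_fun] at h10
      rw [h8]
      change _ ≤ Module.finrank ℝ pb.toLinearMap.ker
      omega
    ext1 b
    change fderiv ℝ β (p (x, l)) (b, 0) = 0
    rw [hβd]
    obtain ⟨⟨v, w⟩, hvw⟩ : ∃ u, u = fderiv ℝ ψ (p (x, l)) (b, 0) := ⟨_, rfl⟩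
    change C (fderiv ℝ ψ (p (x, l)) (b, 0)).2 = 0
    rw [← hvw]
    have h11 : fderiv ℝ G (x, l) (v, w) = 0 := by
      rw [hvw]
      exact DFunLike.congr_fun hGψ (b, 0)
    have h12 : pm w = 0 := by
      have := DFunLike.congr_fun hpψ (b, 0)
      rw [ContinuousLinearMap.comp_apply, ← hvw] at this
      exact congrArg Prod.snd this
    -- Replacing `v` by `v'` in `ker pb` keeps `(v', w)` in the kernel of `DG` and puts it in that
    -- of `p`; injectivity of `(DG, p)` forces `w = 0`.
    obtain ⟨v', hv', hvv'⟩ : A' v ∈ pb.ker.map A'.toLinearMap := hker ▸ ⟨v, rfl⟩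
    have h13 : fderiv ℝ G (x, l) (v', w) = 0 := by
      have h14 : fderiv ℝ G (x, l) (v', 0) = fderiv ℝ G (x, l) (v, 0) := hvv'
      rw [hsplit, h14, ← hsplit, h11]
    have h15 := h3 (v', w) h13 (Prod.ext hv' h12)
    have h16 : w = 0 := congrArg Prod.snd h15
    rw [h16, map_zero]
  · change (pm l, C (ψ (p (x, l))).2) = (pm l, C l)
    rw [hψx]

open MeasureTheory in
/-- Parametric transversality in finite dimensions: for almost every parameter, zero is a regular
value of the partial map. -/
theorem volume_nonregular_parameters_eq_zero {X F : Type*} [NormedAddCommGroup X]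
    [NormedSpace ℝ X] [FiniteDimensional ℝ X] [NormedAddCommGroup F] [NormedSpace ℝ F]
    [FiniteDimensional ℝ F] {d r : ℕ} (hr : 1 ≤ r)
    (hdim : Module.finrank ℝ X < r + Module.finrank ℝ F) (G : X × (Fin d → ℝ) → F) :
    volume (Prod.snd '' {e | ContDiffAt ℝ r G e ∧ G e = 0 ∧ Function.Surjective (fderiv ℝ G e) ∧
      ¬ Function.Surjective (fderiv ℝ G e ∘L ContinuousLinearMap.inl ℝ X (Fin d → ℝ))}) = 0 := by
  set B := {e | ContDiffAt ℝ r G e ∧ G e = 0 ∧ Function.Surjective (fderiv ℝ G e) ∧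
      ¬ Function.Surjective (fderiv ℝ G e ∘L ContinuousLinearMap.inl ℝ X (Fin d → ℝ))} with hB
  let rk : X × (Fin d → ℝ) → ℕ := fun e =>
    Module.finrank ℝ (fderiv ℝ G e ∘L ContinuousLinearMap.inl ℝ X (Fin d → ℝ)).range
  -- On the stratum of rank exactly `ρ`, the rank bound of the local lemma holds automatically.
  have hρ : ∀ ρ : ℕ, volume (Prod.snd '' {e ∈ B | rk e = ρ}) = 0 := by
    intro ρ
    have hloc : ∀ a ∈ {e ∈ B | rk e = ρ}, ∃ N ∈ 𝓝 a,
        volume (Prod.snd '' (N ∩ {e ∈ B | rk e = ρ})) = 0 := by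
      rintro a ⟨⟨h1, h2, h3, h4⟩, ha⟩
      obtain ⟨N, hN, h0⟩ := exists_nhds_volume_eq_zero hr hdim h1 h2 h3 h4
      refine ⟨N, hN, measure_mono_null (Set.image_mono ?_) h0⟩
      rintro e ⟨heN, heB, he⟩
      exact ⟨heN, heB.2.1, (he.trans ha.symm).le⟩
    choose! N hN h0 using hloc
    obtain ⟨t, htB, htc, htcov⟩ := TopologicalSpace.countable_cover_nhdsWithin
      (f := N) fun a ha => mem_nhdsWithin_of_mem_nhds (hN a ha)
    refine measure_mono_null ?_ ((measure_biUnion_null_iff htc).2 fun a ha => h0 a (htB ha))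
    rintro _ ⟨e, he, rfl⟩
    obtain ⟨a, ha, hea⟩ := Set.mem_iUnion₂.1 (htcov he)
    exact Set.mem_biUnion ha ⟨e, ⟨hea, he⟩, rfl⟩
  refine measure_mono_null ?_ (measure_iUnion_null hρ)
  rintro _ ⟨e, he, rfl⟩
  exact Set.mem_iUnion.2 ⟨rk e, e, ⟨he, rfl⟩, rfl⟩

/-! ### Parameters in a Banach space -/

/-- Restricting the parameters to a finite-dimensional subspace keeps `0` a regular value, near a
compact set of the other variable. -/
theorem exists_finiteDimensional_parameters {E L F : Type*} [NormedAddCommGroup E]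
    [NormedSpace ℝ E] [NormedAddCommGroup L] [NormedSpace ℝ L]
    [NormedAddCommGroup F] [NormedSpace ℝ F] [FiniteDimensional ℝ F] {r : ℕ} (hr : 1 ≤ r)
    {G : E × L → F} {K : Set E} (hK : IsCompact K) {l₁ : L}
    (hG : ∀ e ∈ K, ContDiffAt ℝ r G (e, l₁))
    (hreg : ∀ e ∈ K, G (e, l₁) = 0 → Function.Surjective (fderiv ℝ G (e, l₁))) :
    ∃ V : Submodule ℝ L, FiniteDimensional ℝ V ∧ ∀ᶠ l in 𝓝 l₁, ∀ e ∈ K, G (e, l) = 0 →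
      ∀ w : F, ∃ x : E, ∃ v ∈ V, fderiv ℝ G (e, l) (x, v) = w := by
  have hr0 : ((r : ℕ) : WithTop ℕ∞) ≠ 0 := by
    have : r ≠ 0 := by omega
    exact_mod_cast this
  refine hK.induction_on (p := fun s => ∃ V : Submodule ℝ L, FiniteDimensional ℝ V ∧
    ∀ᶠ l in 𝓝 l₁, ∀ e ∈ s, G (e, l) = 0 →
      ∀ w : F, ∃ x : E, ∃ v ∈ V, fderiv ℝ G (e, l) (x, v) = w) ?_ ?_ ?_ ?_
  · exact ⟨⊥, inferInstance, by simp⟩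
  · rintro s t hst ⟨V, hV, h⟩
    exact ⟨V, hV, h.mono fun l hl e he => hl e (hst he)⟩
  · rintro s t ⟨V, hV, h⟩ ⟨V', hV', h'⟩
    refine ⟨V ⊔ V', inferInstance, ?_⟩
    filter_upwards [h, h'] with l hl hl' e he h0 w
    rcases he with he | he
    · obtain ⟨x, v, hv, hw⟩ := hl e he h0 w
      exact ⟨x, v, Submodule.mem_sup_left hv, hw⟩
    · obtain ⟨x, v, hv, hw⟩ := hl' e he h0 w
      exact ⟨x, v, Submodule.mem_sup_right hv, hw⟩
  · intro e he
    obtain ⟨V, hV, h⟩ : ∃ V : Submodule ℝ L, FiniteDimensional ℝ V ∧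
        ∀ᶠ p in 𝓝 (e, l₁), G p = 0 → ∀ w : F, ∃ x : E, ∃ v ∈ V, fderiv ℝ G p (x, v) = w := by
      by_cases h0 : G (e, l₁) = 0
      · obtain ⟨T, hT⟩ :=
          ContinuousLinearMap.exists_eventually_surjective_comp (hreg e he h0)
        -- Only the parameter components of the right inverse `T` are needed, and `T` works for all
        -- nearby derivatives.
        refine ⟨(ContinuousLinearMap.snd ℝ E L ∘L T).range, inferInstance, ?_⟩
        filter_upwards [((hG e he).continuousAt_fderiv hr0).eventually hT] with p hp _ w
        obtain ⟨u, hu⟩ := hp w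
        exact ⟨(T u).1, (T u).2, ⟨u, rfl⟩, hu⟩
      · refine ⟨⊥, inferInstance, ?_⟩
        filter_upwards [(hG e he).continuousAt.eventually_ne h0] with p hp hp0
        exact absurd hp0 hp
    rw [nhds_prod_eq] at h
    obtain ⟨P, hP, Q, hQ, hPQ⟩ := Filter.eventually_prod_iff.1 h
    exact ⟨{e | P e}, mem_nhdsWithin_of_mem_nhds hP, V, hV,
      hQ.mono fun l hl e he => hPQ he hl⟩

/-- Parametric transversality with parameters in a Banach space, near a compact set: the parameters
for which `0` is not a regular value form a nowhere dense set. -/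
theorem isNowhereDense_nonregular_parameters {E L F : Type*} [NormedAddCommGroup E]
    [NormedSpace ℝ E] [FiniteDimensional ℝ E] [NormedAddCommGroup L] [NormedSpace ℝ L]
    [NormedAddCommGroup F] [NormedSpace ℝ F] [FiniteDimensional ℝ F] {r : ℕ} (hr : 1 ≤ r)
    (hdim : Module.finrank ℝ E < r + Module.finrank ℝ F)
    {G : E × L → F} {K : Set E} (hK : IsCompact K) {U : Set L} (hU : IsOpen U)
    (hG : ∀ e ∈ K, ∀ l ∈ U, ContDiffAt ℝ r G (e, l)) {D : Set L} (hD : U ⊆ closure D)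
    (hreg : ∀ l ∈ D, l ∈ U → ∀ e ∈ K, G (e, l) = 0 → Function.Surjective (fderiv ℝ G (e, l))) :
    IsNowhereDense {l ∈ U | ∃ e ∈ K, G (e, l) = 0 ∧
      ¬ Function.Surjective (fderiv ℝ G (e, l) ∘L ContinuousLinearMap.inl ℝ E L)} := by
  have hr0 : ((r : ℕ) : WithTop ℕ∞) ≠ 0 := by
    have : r ≠ 0 := by omega
    exact_mod_cast this
  set B := {l ∈ U | ∃ e ∈ K, G (e, l) = 0 ∧
      ¬ Function.Surjective (fderiv ℝ G (e, l) ∘L ContinuousLinearMap.inl ℝ E L)} with hB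
  -- The bad set is closed in `U`: over compact `K`, being nonzero and being onto are both open
  -- conditions.
  have hrel : ∀ l ∈ U, l ∈ closure B → l ∈ B := by
    intro l hl hlB
    by_contra hlB'
    have hev : ∀ᶠ l' in 𝓝 l, ∀ e ∈ K, ¬ (G (e, l') = 0 ∧
        ¬ Function.Surjective (fderiv ℝ G (e, l') ∘L ContinuousLinearMap.inl ℝ E L)) := by
      refine hK.eventually_forall_of_forall_eventually fun e he => ?_
      have hc : Filter.Tendsto (fun p : L × E => (p.2, p.1)) (𝓝 (l, e)) (𝓝 (e, l)) :=
        continuous_swap.tendsto _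
      by_cases h0 : G (e, l) = 0
      · have hs : Function.Surjective (fderiv ℝ G (e, l) ∘L ContinuousLinearMap.inl ℝ E L) := by
          by_contra hs
          exact hlB' ⟨hl, e, he, h0, hs⟩
        have h1 : ContinuousAt
            (fun p => fderiv ℝ G p ∘L ContinuousLinearMap.inl ℝ E L) (e, l) :=
          ((hG e he l hl).continuousAt_fderiv hr0).clm_comp continuousAt_const
        filter_upwards [hc.eventually (h1.eventually
          (ContinuousLinearMap.eventually_surjective hs))] with p hp hp'
        exact hp'.2 hp
      · filter_upwards [hc.eventually ((hG e he l hl).continuousAt.eventually_ne h0)] with p hp hp'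
        exact hp hp'.1
    obtain ⟨l', hl', hl'B⟩ := mem_closure_iff_nhds.1 hlB _ hev
    obtain ⟨-, e, he, h⟩ := hl'B
    exact hl' e he h
  rw [IsNowhereDense, Set.eq_empty_iff_forall_notMem]
  intro l₀ hl₀
  obtain ⟨V, hVB, hV, hl₀V⟩ := mem_interior.1 hl₀
  obtain ⟨l₂, hl₂V, hl₂B⟩ := mem_closure_iff.1 (hVB hl₀V) V hV hl₀V
  obtain ⟨l₁, ⟨hl₁V, hl₁U⟩, hl₁D⟩ :=
    mem_closure_iff.1 (hD hl₂B.1) (V ∩ U) (hV.inter hU) ⟨hl₂V, hl₂B.1⟩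
  obtain ⟨P, hP, hev⟩ := exists_finiteDimensional_parameters hr hK
    (fun e he => hG e he l₁ hl₁U) (hreg l₁ hl₁D hl₁U)
  let c : (Fin (Module.finrank ℝ P) → ℝ) ≃ₗ[ℝ] P :=
    LinearEquiv.ofFinrankEq _ _ (Module.finrank_fin_fun ℝ)
  let ι : (Fin (Module.finrank ℝ P) → ℝ) →L[ℝ] L :=
    (P.subtype ∘ₗ c.toLinearMap).toContinuousLinearMap
  have hι : ∀ v ∈ P, ∃ t, ι t = v := by
    intro v hv
    obtain ⟨t, ht⟩ := c.surjective ⟨v, hv⟩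
    exact ⟨t, congrArg Subtype.val ht⟩
  let S : E × (Fin (Module.finrank ℝ P) → ℝ) → E × L := fun p => (p.1, l₁ + ι p.2)
  let S' : E × (Fin (Module.finrank ℝ P) → ℝ) →L[ℝ] E × L :=
    (ContinuousLinearMap.id ℝ E).prodMap ι
  have hS : ContDiff ℝ r S :=
    contDiff_fst.prodMk (contDiff_const.add (ι.contDiff.comp contDiff_snd))
  have hS' : ∀ p, HasFDerivAt S S' p := fun p =>
    hasFDerivAt_fst.prodMk ((ι.hasFDerivAt.comp p hasFDerivAt_snd).const_add l₁)
  have hnull := volume_nonregular_parameters_eq_zero hr hdim (G ∘ S)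
  have hnear : ∀ᶠ t in 𝓝 (0 : Fin (Module.finrank ℝ P) → ℝ), l₁ + ι t ∈ V ∩ U ∧
      ∀ e ∈ K, G (e, l₁ + ι t) = 0 →
      ∀ w : F, ∃ x : E, ∃ v ∈ P, fderiv ℝ G (e, l₁ + ι t) (x, v) = w := by
    have hc : Filter.Tendsto (fun t => l₁ + ι t) (𝓝 0) (𝓝 l₁) := by
      have : Continuous fun t => l₁ + ι t := continuous_const.add ι.continuous
      simpa using this.tendsto 0
    exact hc.eventually (Filter.Eventually.and ((hV.inter hU).eventually_mem ⟨hl₁V, hl₁U⟩) hev)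
  obtain ⟨t, ht, htn⟩ : ∃ t, (l₁ + ι t ∈ V ∩ U ∧
      ∀ e ∈ K, G (e, l₁ + ι t) = 0 →
      ∀ w : F, ∃ x : E, ∃ v ∈ P, fderiv ℝ G (e, l₁ + ι t) (x, v) = w) ∧
      t ∉ Prod.snd '' {p | ContDiffAt ℝ r (G ∘ S) p ∧ (G ∘ S) p = 0 ∧
        Function.Surjective (fderiv ℝ (G ∘ S) p) ∧ ¬ Function.Surjective
          (fderiv ℝ (G ∘ S) p ∘L ContinuousLinearMap.inl ℝ E _)} := by
    by_contra! hcon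
    -- A neighbourhood of `0` has positive measure, so it contains a `t` outside the null set; yet
    -- `l₁ + ι t` lies in `V ∩ U`, hence in `B`.
    have hpos := MeasureTheory.Measure.measure_pos_of_mem_nhds MeasureTheory.volume hnear
    exact hpos.ne' (MeasureTheory.measure_mono_null (fun t ht => hcon t ht) hnull)
  obtain ⟨⟨htV, htU⟩, htP⟩ := ht
  obtain ⟨-, e, he, h0, hns⟩ := hrel _ htU (hVB htV)
  have hGe := hG e he _ htU
  have hfd : fderiv ℝ (G ∘ S) (e, t) = fderiv ℝ G (e, l₁ + ι t) ∘L S' :=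
    (HasFDerivAt.comp (e, t) (hGe.differentiableAt hr0).hasFDerivAt (hS' (e, t))).fderiv
  refine htn ⟨(e, t), ⟨ContDiffAt.comp (e, t) hGe hS.contDiffAt, h0, ?_, ?_⟩, rfl⟩
  · intro w
    obtain ⟨x, v, hv, hw⟩ := htP e he h0 w
    obtain ⟨t', rfl⟩ := hι v hv
    exact ⟨(x, t'), by rw [hfd]; exact hw⟩
  · intro hs
    refine hns fun w => ?_
    obtain ⟨x, hx⟩ := hs w
    refine ⟨x, ?_⟩
    rw [← hx, hfd]
    simp [S']

/-! ### Defining functions and transversality as surjectivity -/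

/-- Near each of its points, a submanifold of codimension `m` is the zero set of a submersion to
`ℝ^m`, and its tangent spaces are the kernels of the derivative. -/
theorem IsSubmanifoldOfCodim.exists_definingFunction {Y : Type*} [NormedAddCommGroup Y]
    [NormedSpace ℝ Y] {r : WithTop ℕ∞} (hr : r ≠ 0) {m : ℕ} {W : Set Y}
    (hW : IsSubmanifoldOfCodim r m W) {w : Y} (hw : w ∈ W) :
    ∃ (V : Set Y) (h : Y → (Fin m → ℝ)), IsOpen V ∧ w ∈ V ∧ ContDiffOn ℝ r h V ∧
      (∀ y ∈ V, y ∈ W ↔ h y = 0) ∧ (∀ y ∈ V, Function.Surjective (fderiv ℝ h y)) ∧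
      ∀ y ∈ V, y ∈ W → submanifoldTangentSpace W y = (fderiv ℝ h y).ker := by
  obtain ⟨φ, K, hwφ, hφ, hφs, hK, hKm, hWK⟩ := hW w hw
  obtain ⟨c, hcs, hc⟩ : ∃ c : Y →L[ℝ] (Fin m → ℝ), Function.Surjective c ∧
      ∀ v, c v = 0 ↔ v ∈ K := by
    have hfin : Module.finrank ℝ (Y ⧸ K) = m := Module.finrank_eq_of_rank_eq hKm
    have : Module.Finite ℝ (Y ⧸ K) := by
      rw [← Module.rank_lt_aleph0_iff, hKm]
      exact Cardinal.natCast_lt_aleph0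
    let e : (Y ⧸ K) ≃ₗ[ℝ] (Fin m → ℝ) := LinearEquiv.ofFinrankEq _ _ (by simp [hfin])
    have hker : ∀ v, (e.toLinearMap ∘ₗ K.mkQ) v = 0 ↔ v ∈ K := by
      intro v
      change e (K.mkQ v) = 0 ↔ _
      rw [map_eq_zero_iff e e.injective]
      exact Submodule.Quotient.mk_eq_zero K
    have : IsClosed (K : Set Y) := hK
    have hcont : Continuous (e.toLinearMap ∘ₗ K.mkQ) :=
      (LinearMap.continuous_of_finiteDimensional e.toLinearMap).comp continuous_quot_mk
    exact ⟨⟨e.toLinearMap ∘ₗ K.mkQ, hcont⟩, e.surjective.comp K.mkQ_surjective, hker⟩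
  have hφd : ∀ y ∈ φ.source, HasFDerivAt φ (fderiv ℝ φ y) y := fun y hy =>
    ((hφ.contDiffAt (φ.open_source.mem_nhds hy)).differentiableAt hr).hasFDerivAt
  have hφsd : ∀ z ∈ φ.target, HasFDerivAt φ.symm (fderiv ℝ φ.symm z) z := fun z hz =>
    ((hφs.contDiffAt (φ.open_target.mem_nhds hz)).differentiableAt hr).hasFDerivAt
  have hfd : ∀ y ∈ φ.source, fderiv ℝ (c ∘ φ) y = c ∘L fderiv ℝ φ y := fun y hy =>
    (c.hasFDerivAt.comp y (hφd y hy)).fderiv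
  have hright : ∀ y ∈ φ.source, ∀ v, fderiv ℝ φ y (fderiv ℝ φ.symm (φ y) v) = v := by
    intro y hy v
    have h1 : HasFDerivAt φ (fderiv ℝ φ y) (φ.symm (φ y)) := by
      rw [φ.left_inv hy]
      exact hφd y hy
    have h2 := h1.comp (φ y) (hφsd _ (φ.map_source hy))
    have h3 := h2.unique ((hasFDerivAt_id _).congr_of_eventuallyEq
      (φ.eventually_right_inverse (φ.map_source hy)))
    exact DFunLike.congr_fun h3 v
  have hleft : ∀ y ∈ φ.source, ∀ v, fderiv ℝ φ.symm (φ y) (fderiv ℝ φ y v) = v := by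
    intro y hy v
    have h2 := (hφsd _ (φ.map_source hy)).comp y (hφd y hy)
    have h3 := h2.unique ((hasFDerivAt_id _).congr_of_eventuallyEq (φ.eventually_left_inverse hy))
    exact DFunLike.congr_fun h3 v
  refine ⟨φ.source, c ∘ φ, φ.open_source, hwφ, c.contDiff.comp_contDiffOn hφ,
    fun y hy => (hWK y hy).trans (hc _).symm, fun y hy => ?_, fun y hy hyW => ?_⟩
  · rw [hfd y hy]
    exact hcs.comp fun v => ⟨_, hright y hy v⟩
  · refine le_antisymm (Submodule.span_le.2 ?_) ?_
    · rintro v ⟨γ, hγ0, hγW, hγ⟩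
      have h1 : HasFDerivAt (c ∘ φ) (c ∘L fderiv ℝ φ y) (γ 0) := by
        rw [hγ0]
        exact c.hasFDerivAt.comp y (hφd y hy)
      have h2 := h1.comp_hasDerivAt 0 hγ
      have h3 : (c ∘ φ) ∘ γ =ᶠ[𝓝 0] fun _ => 0 := by
        filter_upwards [hγW, hγ.continuousAt.eventually_mem
          (φ.open_source.mem_nhds (hγ0 ▸ hy))] with t ht ht'
        exact (hc _).2 ((hWK _ ht').1 ht)
      have h4 := h2.unique ((hasDerivAt_const (0 : ℝ) (0 : Fin m → ℝ)).congr_of_eventuallyEq h3)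
      change fderiv ℝ (c ∘ φ) y v = 0
      rw [hfd y hy]
      exact h4
    · intro v hv
      refine Submodule.subset_span ?_
      have hk : fderiv ℝ φ y v ∈ K := by
        rw [← hc]
        change fderiv ℝ (c ∘ φ) y v = 0 at hv
        rwa [hfd y hy] at hv
      have hline : HasDerivAt (fun t : ℝ => φ y + t • fderiv ℝ φ y v) (fderiv ℝ φ y v) 0 := by
        simpa using ((hasDerivAt_id (0 : ℝ)).smul_const (fderiv ℝ φ y v)).const_add (φ y)
      have h0 : φ y + (0 : ℝ) • fderiv ℝ φ y v = φ y := by simp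
      -- The flattened submanifold is linear, so the chart pulls a straight line in `K` back to a
      -- curve in `W` with velocity `v`.
      refine ⟨fun t => φ.symm (φ y + t • fderiv ℝ φ y v), ?_, ?_, ?_⟩
      · simp only [h0, φ.left_inv hy]
      · have : ∀ᶠ t in 𝓝 (0 : ℝ), φ y + t • fderiv ℝ φ y v ∈ φ.target :=
          hline.continuousAt.eventually_mem
            (φ.open_target.mem_nhds (by rw [h0]; exact φ.map_source hy))
        filter_upwards [this] with t ht
        rw [hWK _ (φ.map_target ht), φ.right_inv ht]
        exact K.add_mem ((hWK y hy).1 hyW) (K.smul_mem t hk)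
      · have h1 : HasFDerivAt φ.symm (fderiv ℝ φ.symm (φ y)) (φ y + (0 : ℝ) • fderiv ℝ φ y v) := by
          rw [h0]
          exact hφsd _ (φ.map_source hy)
        have h2 := h1.comp_hasDerivAt 0 hline
        rwa [hleft y hy] at h2

/-- For the kernel of a surjection `A` onto a finite-dimensional space, the splitting conditions in
the definition of transversality amount to surjectivity of `A ∘ D`. -/
theorem splitting_conditions_iff_surjective {E Y F : Type*} [NormedAddCommGroup E]
    [NormedSpace ℝ E] [NormedAddCommGroup Y] [NormedSpace ℝ Y] [NormedAddCommGroup F]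
    [NormedSpace ℝ F] [FiniteDimensional ℝ F] (D : E →L[ℝ] Y) {A : Y →L[ℝ] F}
    (hA : Function.Surjective A) :
    ((IsClosed ((A.ker.comap D.toLinearMap : Submodule ℝ E) : Set E) ∧
        ∃ Q : Submodule ℝ E, IsClosed (Q : Set E) ∧ IsCompl (A.ker.comap D.toLinearMap) Q) ∧
      ∃ C : Submodule ℝ Y, IsClosed (C : Set Y) ∧ IsCompl A.ker C ∧ C ≤ D.toLinearMap.range) ↔
    Function.Surjective (A ∘L D) := by
  constructor
  · rintro ⟨-, C, -, hC, hCD⟩ w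
    obtain ⟨u, rfl⟩ := hA w
    obtain ⟨t, ht, v, hv, rfl⟩ := Submodule.mem_sup.1 (hC.sup_eq_top ▸ Submodule.mem_top (x := u))
    obtain ⟨x, rfl⟩ := hCD hv
    refine ⟨x, ?_⟩
    have : A t = 0 := ht
    rw [map_add, this, zero_add]
    rfl
  · intro hs
    have hker : A.ker.comap D.toLinearMap = (A ∘L D).ker := rfl
    refine ⟨⟨?_, ?_⟩, ?_⟩
    · rw [hker]
      exact (A ∘L D).isClosed_ker
    · rw [hker]
      exact ((A ∘L D).ker_closedComplemented_of_finiteDimensional_range).exists_isClosed_isCompl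
    · obtain ⟨T, hT⟩ := (A ∘L D).exists_rightInverse_of_surjective (LinearMap.range_eq_top.2 hs)
      have hT' : ∀ w, A (D (T w)) = w := DFunLike.congr_fun hT
      -- With `T` a right inverse of `A ∘ D`, the map `D ∘ T ∘ A` is a projection along `ker A`; its
      -- range is the required complement, closed since it is finite-dimensional.
      refine ⟨(D ∘L T).range, Submodule.closed_of_finiteDimensional _, ?_, ?_⟩
      · refine IsCompl.of_le ?_ ?_
        · rintro _ ⟨h1, w, rfl⟩
          have h2 : A (D (T w)) = 0 := h1
          rw [hT'] at h2
          simp [h2]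
        · intro y _
          refine Submodule.mem_sup.2 ⟨y - D (T (A y)), ?_, D (T (A y)), ⟨A y, rfl⟩, by abel⟩
          change A (y - D (T (A y))) = 0
          rw [map_sub, hT', sub_self]
      · rintro _ ⟨w, rfl⟩
        exact ⟨T w, rfl⟩

theorem isTransversalAt_iff_surjective {E : Type*} [NormedAddCommGroup E] [NormedSpace ℝ E]
    {H : Type*} [TopologicalSpace H] (I : ModelWithCorners ℝ E H)
    {M : Type*} [TopologicalSpace M] [ChartedSpace H M]
    {Y : Type*} [NormedAddCommGroup Y] [NormedSpace ℝ Y] {F : Type*} [NormedAddCommGroup F]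
    [NormedSpace ℝ F] [FiniteDimensional ℝ F] {f : M → Y} {W : Set Y} {x : M} (hx : f x ∈ W)
    {A : Y →L[ℝ] F} (hA : Function.Surjective A) (hT : submanifoldTangentSpace W (f x) = A.ker) :
    IsTransversalAt I f W x ↔ Function.Surjective fun v => A (mfderiv I 𝓘(ℝ, Y) f x v) := by
  have h := @splitting_conditions_iff_surjective E Y F _ _ _ _ _ _ _ (mfderiv I 𝓘(ℝ, Y) f x) A hA
  refine Iff.trans ?_ h
  simp only [IsTransversalAt, hT, hx, not_true_eq_false, false_or, true_and]
  rfl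

/-- Surjectivity of the derivative can be checked in any chart. -/
theorem surjective_fderiv_comp_extChartAt_symm_iff {E : Type*} [NormedAddCommGroup E]
    [NormedSpace ℝ E] {H : Type*} [TopologicalSpace H] (I : ModelWithCorners ℝ E H)
    [I.Boundaryless] {M : Type*} [TopologicalSpace M] [ChartedSpace H M] [IsManifold I 1 M]
    {Y F : Type*} [NormedAddCommGroup Y] [NormedSpace ℝ Y] [NormedAddCommGroup F]
    [NormedSpace ℝ F] {f : M → Y} {h : Y → F} {x₀ : M} {p : E}
    (hp : p ∈ (extChartAt I x₀).target)
    (hf : MDifferentiableAt I 𝓘(ℝ, Y) f ((extChartAt I x₀).symm p))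
    (hh : DifferentiableAt ℝ h (f ((extChartAt I x₀).symm p))) :
    Function.Surjective (fderiv ℝ (fun e => h (f ((extChartAt I x₀).symm e))) p) ↔
      Function.Surjective fun v => fderiv ℝ h (f ((extChartAt I x₀).symm p))
        (mfderiv I 𝓘(ℝ, Y) f ((extChartAt I x₀).symm p) v) := by
  have hinv := isInvertible_mfderivWithin_extChartAt_symm hp
  have hsd := mdifferentiableWithinAt_extChartAt_symm hp
  simp only [I.range_eq_univ, mfderivWithin_univ, mdifferentiableWithinAt_univ] at hinv hsd
  have h1 := hh.hasFDerivAt.hasMFDerivAt.comp p (hf.hasMFDerivAt.comp p hsd.hasMFDerivAt)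
  have h2 := h1.mfderiv
  rw [mfderiv_eq_fderiv] at h2
  obtain ⟨e, he⟩ := hinv
  have key : ∀ v, fderiv ℝ (fun e => h (f ((extChartAt I x₀).symm e))) p v =
      fderiv ℝ h (f ((extChartAt I x₀).symm p))
        (mfderiv I 𝓘(ℝ, Y) f ((extChartAt I x₀).symm p) (e v)) := fun v =>
    (congrArg (fun B : E →L[ℝ] F => B v) h2).trans (congrArg (fun u => fderiv ℝ h (f ((extChartAt I x₀).symm p))
        (mfderiv I 𝓘(ℝ, Y) f ((extChartAt I x₀).symm p) u)) (DFunLike.congr_fun he v).symm)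
  constructor
  · intro hs w
    obtain ⟨v, rfl⟩ := hs w
    exact ⟨e v, (key v).symm⟩
  · intro hs w
    obtain ⟨u, rfl⟩ := hs w
    refine ⟨e.symm u, (key _).trans ?_⟩
    rw [e.apply_symm_apply]

/-! ### Localization and countable covering -/

/-- Near a point `z₀` with `Φ z₀ ∈ W`, the parameters of non-transversal points form a nowhere dense
set. -/
theorem exists_nhds_isNowhereDense_nontransversal {r n m : ℕ} (hr : 1 ≤ r) (hnm : n < r + m)
    {M : Type*} [TopologicalSpace M]
    [ChartedSpace (EuclideanSpace ℝ (Fin n)) M] [IsManifold (𝓡 n) r M]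
    {Y : Type*} [NormedAddCommGroup Y] [NormedSpace ℝ Y]
    {W : Set Y} (hW : IsSubmanifoldOfCodim r m W)
    {L : Type*} [NormedAddCommGroup L] [NormedSpace ℝ L]
    {Λ : TopologicalSpace.Opens L} {Λhat : Set Λ} (hΛhat : Dense Λhat)
    {Φ : M × Λ → Y} (hΦ : ContMDiff ((𝓡 n).prod 𝓘(ℝ, L)) 𝓘(ℝ, Y) r Φ)
    (htrans : ∀ x : M, ∀ l ∈ Λhat, IsTransversalAt ((𝓡 n).prod 𝓘(ℝ, L)) Φ W (x, l))
    {z₀ : M × Λ} (hz₀ : Φ z₀ ∈ W) :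
    ∃ N ∈ 𝓝 z₀, ∃ B : Set L, IsNowhereDense B ∧ ∀ x l, (x, l) ∈ N → Φ (x, l) ∈ W →
      ¬ IsTransversalAt (𝓡 n) (fun x' : M => Φ (x', l)) W x → (l : L) ∈ B := by
  have hr0 : ((r : ℕ) : WithTop ℕ∞) ≠ 0 := by
    have : r ≠ 0 := by omega
    exact_mod_cast this
  have hr1 : (1 : WithTop ℕ∞) ≤ r := by exact_mod_cast hr
  have : IsManifold (𝓡 n) 1 M := IsManifold.of_le hr1
  obtain ⟨V, h, hV, hzV, hh, hWh, hsurj, hT⟩ := hW.exists_definingFunction hr0 hz₀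
  let J := (𝓡 n).prod 𝓘(ℝ, L)
  let s := extChartAt J z₀
  have hs_cont : ContinuousOn s.symm s.target := continuousOn_extChartAt_symm z₀
  have hst : IsOpen s.target := isOpen_extChartAt_target z₀
  let O : Set (EuclideanSpace ℝ (Fin n) × L) := s.target ∩ s.symm ⁻¹' (Φ ⁻¹' V)
  have hO : IsOpen O := hs_cont.isOpen_inter_preimage hst (hV.preimage hΦ.continuous)
  let G : EuclideanSpace ℝ (Fin n) × L → (Fin m → ℝ) := fun p => h (Φ (s.symm p))
  have hhd : ∀ y ∈ V, DifferentiableAt ℝ h y := fun y hy =>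
    (hh.contDiffAt (hV.mem_nhds hy)).differentiableAt hr0
  have hG : ∀ p ∈ O, ContDiffAt ℝ r G p := by
    intro p hp
    have h1 : ContMDiffAt 𝓘(ℝ, EuclideanSpace ℝ (Fin n) × L) J r s.symm p :=
      (contMDiffOn_extChartAt_symm z₀).contMDiffAt (hst.mem_nhds hp.1)
    have h2 := (hΦ (s.symm p)).comp p h1
    have h3 : ContDiffAt ℝ r (Φ ∘ s.symm) p := h2.contDiffAt
    exact (hh.contDiffAt (hV.mem_nhds hp.2)).comp p h3
  -- The chart of the product leaves the parameter unchanged: on the open set `Λ` it is the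
  -- inclusion into `L`.
  have hsl : ∀ p ∈ s.target, s.symm p = ((extChartAt (𝓡 n) z₀.1).symm p.1, (s.symm p).2) ∧
      ((s.symm p).2 : L) = p.2 := by
    intro p hp
    refine ⟨?_, ?_⟩
    · rfl
    · have h1 := s.right_inv hp
      exact congrArg Prod.snd h1
  have hreg : ∀ p ∈ O, G p = 0 → (s.symm p).2 ∈ Λhat → Function.Surjective (fderiv ℝ G p) := by
    intro p hp hp0 hpl
    have hpW : Φ (s.symm p) ∈ W := (hWh _ hp.2).2 hp0
    have h1 := htrans (s.symm p).1 (s.symm p).2 hpl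
    rw [Prod.mk.eta, isTransversalAt_iff_surjective _ hpW (hsurj _ hp.2) (hT _ hp.2 hpW)] at h1
    exact (surjective_fderiv_comp_extChartAt_symm_iff J hp.1
      ((hΦ _).mdifferentiableAt hr0) (hhd _ hp.2)).2 h1
  have hslice : ∀ p ∈ O, G p = 0 →
      Function.Surjective (fderiv ℝ G p ∘L ContinuousLinearMap.inl ℝ (EuclideanSpace ℝ (Fin n)) L) →
      IsTransversalAt (𝓡 n) (fun x' : M => Φ (x', (s.symm p).2)) W (s.symm p).1 := by
    rintro ⟨e, l⟩ hp hp0 hps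
    set l' := (s.symm (e, l)).2 with hl'
    have hse : s.symm (e, l) = ((extChartAt (𝓡 n) z₀.1).symm e, l') := (hsl _ hp.1).1
    have he : e ∈ (extChartAt (𝓡 n) z₀.1).target := by
      have h1 := hp.1
      simp only [s, J, extChartAt_prod] at h1
      exact h1.1
    rw [hse]
    change IsTransversalAt (𝓡 n) (fun x' : M => Φ (x', l')) W ((extChartAt (𝓡 n) z₀.1).symm e)
    have hyV : Φ ((extChartAt (𝓡 n) z₀.1).symm e, l') ∈ V := hse ▸ hp.2
    have hyW : Φ ((extChartAt (𝓡 n) z₀.1).symm e, l') ∈ W := by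
      rw [hWh _ hyV, ← hse]
      exact hp0
    have hΦl : ContMDiff (𝓡 n) 𝓘(ℝ, Y) r fun x' : M => Φ (x', l') :=
      hΦ.comp (contMDiff_id.prodMk contMDiff_const)
    rw [isTransversalAt_iff_surjective (f := fun x' : M => Φ (x', l')) _ hyW (hsurj _ hyV)
      (hT _ hyV hyW)]
    refine (surjective_fderiv_comp_extChartAt_symm_iff (f := fun x' : M => Φ (x', l')) (𝓡 n) he
      ((hΦl _).mdifferentiableAt hr0) (hhd _ hyV)).1 ?_
    have h2 : HasFDerivAt (fun e' => G (e', l))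
        (fderiv ℝ G (e, l) ∘L ContinuousLinearMap.inl ℝ (EuclideanSpace ℝ (Fin n)) L) e :=
      HasFDerivAt.comp (f := fun e' => (e', l)) e
        ((hG _ hp).differentiableAt hr0).hasFDerivAt (hasFDerivAt_prodMk_left e l)
    have h3 : (fun e' => h (Φ ((extChartAt (𝓡 n) z₀.1).symm e', l'))) =ᶠ[𝓝 e]
        fun e' => G (e', l) := by
      have h4 : ∀ᶠ e' in 𝓝 e, (e', l) ∈ s.target :=
        (continuous_id.prodMk continuous_const).continuousAt.eventually_mem
          (hst.mem_nhds hp.1)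
      filter_upwards [h4] with e' he'
      have h5 := hsl _ he'
      have h6 : (s.symm (e', l)).2 = l' := Subtype.ext (h5.2.trans (hsl _ hp.1).2.symm)
      rw [h6] at h5
      simp only [G, h5.1]
    rw [h3.fderiv_eq, h2.fderiv]
    exact hps
  have hz₀O : s z₀ ∈ O := by
    refine ⟨s.map_source (mem_extChartAt_source z₀), ?_⟩
    rw [Set.mem_preimage, s.left_inv (mem_extChartAt_source z₀)]
    exact hzV
  obtain ⟨K₀, hK₀, U₀, hU₀, hKU⟩ := mem_nhds_prod_iff.1 (hO.mem_nhds hz₀O)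
  obtain ⟨K, hK, hKK₀, hKc⟩ := local_compact_nhds hK₀
  obtain ⟨U, hUU₀, hU, hzU⟩ := mem_nhds_iff.1 hU₀
  have hKUO : ∀ e ∈ K, ∀ l ∈ U, (e, l) ∈ O := fun e he l hl => hKU ⟨hKK₀ he, hUU₀ hl⟩
  have hcont : ContinuousAt s z₀ := continuousAt_extChartAt z₀
  refine ⟨s.source ∩ s ⁻¹' (K ×ˢ U), Filter.inter_mem (extChartAt_source_mem_nhds z₀)
    (hcont (prod_mem_nhds hK (hU.mem_nhds hzU))), _,
    isNowhereDense_nonregular_parameters hr (by simpa using hnm) hKc hU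
      (fun e he l hl => hG _ (hKUO e he l hl)) (D := Subtype.val '' Λhat) ?_ ?_, ?_⟩
  · intro l hl
    refine Subtype.dense_iff.1 hΛhat ?_
    have hval : ((s.symm ((s z₀).1, l)).2 : L) = l := (hsl _ (hKUO _ (mem_of_mem_nhds hK) l hl).1).2
    exact hval ▸ (s.symm ((s z₀).1, l)).2.2
  · rintro _ ⟨l, hl, rfl⟩ hlU e he h0
    have hO' := hKUO e he _ hlU
    refine hreg _ hO' h0 ?_
    have : (s.symm (e, (l : L))).2 = l := Subtype.ext (hsl _ hO'.1).2
    rwa [this]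
  · rintro x l ⟨hxs, hxK⟩ hxW hnt
    have hl : (s (x, l)).2 = l := rfl
    have hxO : s (x, l) ∈ O := hKUO _ hxK.1 _ hxK.2
    have hsx : s.symm (s (x, l)) = (x, l) := s.left_inv hxs
    have hG0 : G (s (x, l)) = 0 := by
      have := hxO.2
      simp only [Set.mem_preimage, hsx] at this
      simp only [G, hsx]
      exact (hWh _ this).1 hxW
    refine ⟨hxK.2, (s (x, l)).1, hxK.1, hG0, fun hsj => hnt ?_⟩
    have := hslice _ hxO hG0 hsj
    rwa [hsx] at this

theorem theoremB3
    (r : ℕ∞) (hr : 1 ≤ r) (n m : ℕ)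
    {M : Type*} [TopologicalSpace M] [SecondCountableTopology M]
    [ChartedSpace (EuclideanSpace ℝ (Fin n)) M] [IsManifold (𝓡 n) r M]
    {Y : Type*} [NormedAddCommGroup Y] [NormedSpace ℝ Y] [CompleteSpace Y]
    (W : Set Y) (hW : IsSubmanifoldOfCodim r m W)
    {L : Type*} [NormedAddCommGroup L] [NormedSpace ℝ L] [CompleteSpace L]
    [TopologicalSpace.SeparableSpace L]
    (Λ : TopologicalSpace.Opens L) (Λhat : Set Λ) (hΛhat : Dense Λhat)
    (Φ : M × Λ → Y) (hΦ : ContMDiff ((𝓡 n).prod 𝓘(ℝ, L)) 𝓘(ℝ, Y) r Φ)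
    (hrnm : (n : ℕ∞) < r + m)
    (htrans : ∀ x : M, ∀ l ∈ Λhat, IsTransversalAt ((𝓡 n).prod 𝓘(ℝ, L)) Φ W (x, l)) :
    {l : Λ | ∀ x : M, IsTransversalAt (𝓡 n) (fun x' : M => Φ (x', l)) W x} ∈ residual Λ := by
  -- A finite smoothness order suffices; for `r = ∞` the choice `n + 1` exceeds `n - m`.
  obtain ⟨k, hk, hkn, hkr⟩ : ∃ k : ℕ, 1 ≤ k ∧ n < k + m ∧ (k : ℕ∞) ≤ r := by
    cases r with
    | top => exact ⟨n + 1, by omega, by omega, le_top⟩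
    | coe r => exact ⟨r, by exact_mod_cast hr, by exact_mod_cast hrnm, le_rfl⟩
  have hkr' : ((k : ℕ) : WithTop ℕ∞) ≤ r := by exact_mod_cast hkr
  have : IsManifold (𝓡 n) k M := IsManifold.of_le hkr'
  have hWk : IsSubmanifoldOfCodim k m W := by
    intro w hw
    obtain ⟨φ, K, h1, h2, h3, h4⟩ := hW w hw
    exact ⟨φ, K, h1, h2.of_le hkr', h3.of_le hkr', h4⟩
  have : SecondCountableTopology L := UniformSpace.secondCountable_of_separable L
  have hloc : ∀ z ∈ Φ ⁻¹' W, ∃ N ∈ 𝓝 z, ∃ B : Set L, IsNowhereDense B ∧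
      ∀ x l, (x, l) ∈ N → Φ (x, l) ∈ W →
        ¬ IsTransversalAt (𝓡 n) (fun x' : M => Φ (x', l)) W x → (l : L) ∈ B := fun z hz =>
    exists_nhds_isNowhereDense_nontransversal hk hkn hWk hΛhat (hΦ.of_le hkr') htrans hz
  choose! N hN B hB hNB using hloc
  -- The Lindelöf property is applied to `Φ ⁻¹' W` itself, so `W` need not be closed.
  obtain ⟨t, htW, htc, htcov⟩ := TopologicalSpace.countable_cover_nhdsWithin
    (s := Φ ⁻¹' W) (f := N) fun z hz => mem_nhdsWithin_of_mem_nhds (hN z hz)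
  have : Countable t := htc.to_subtype
  have hmeagre : IsMeagre (⋃ z : t, (Subtype.val ⁻¹' B z : Set Λ)) :=
    isMeagre_iUnion fun z => (hB z (htW z.2)).isMeagre.preimage_of_isOpenMap
      continuous_subtype_val Λ.isOpen.isOpenMap_subtype_val
  refine Filter.mem_of_superset hmeagre fun l hl x => ?_
  by_contra hnt
  have hxW : Φ (x, l) ∈ W := by
    by_contra hxW
    exact hnt (Or.inl hxW)
  obtain ⟨z, hz, hzN⟩ := Set.mem_iUnion₂.1 (htcov hxW)
  exact hl (Set.mem_iUnion.2 ⟨⟨z, hz⟩, hNB z (htW hz) x l hzN hxW hnt⟩)
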